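/- Let $N\in\mathbb N$ and let $A=(a_{ij})\in\mathbb R^{N\times N}$ be a Metzler matrix ($a_{ij}\ge 0$ for $i\ne j$) with $A^T\mathbf 1=0$. Let $y^0\in\mathbb R^N_{>0}$, and let $y^*$ be a steady state of the initial value problem $y'=Ay$, $y(0)=y^0$, i.e. $Ay^*=0$ and $n^Ty^*=n^Ty^0$ for all $n\in\ker(A^T)$. Suppose that $y^*$ is positive. Then $y^*$ is the unique steady state of the initial value problem, and the iterates of SSPMPRK3($\eta_2$) converge locally to $y^*$ for all $\Delta t>0$ and all $\eta_2\in[0,r_1]$, $r_1=0.37110619221712509$, in the following sense. For each such $\Delta t,\eta_2$ (and exponent $s$, see below) there is $\delta>0$ such that for every starting value $z\in\mathbb R^N_{>0}$ with $n^Tz=n^Ty^*$ for all $n\in\ker(A^T)$ and $\|z-y^*\|<\delta$, there is exactly one sequence of iterates $(y^n)_{n\ge0}$ of the scheme with $y^{0}=z$; all its members are positive, and $y^n\to y^*$ as $n\to\infty$. Here $y'=Ay$ is written as the production-destruction system with $p_{ij}(y)=d_{ji}(y)=a_{ij}y_j$ for $i\ne j$ and $p_{ii}=d_{ii}=0$,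 and one step $y^n\mapsto y^{n+1}$ of SSPMPRK3($\eta_2$) is given by $$\begin{aligned} y_i^{(1)}&=y_i^n+\beta_{10}\Delta t\Big(\sum_j p_{ij}(y^n)\tfrac{y_j^{(1)}}{y_j^n}-\sum_j d_{ij}(y^n)\tfrac{y_i^{(1)}}{y_i^n}\Big),\qquad \rho_i=n_1y_i^{(1)}+n_2y_i^n\Big(\tfrac{y_i^{(1)}}{y_i^n}\Big)^2,\\ y_i^{(2)}&=\alpha_{20}y_i^n+\alpha_{21}y_i^{(1)}+\Delta t\Big(\sum_j\big(\beta_{20}p_{ij}(y^n)+\beta_{21}p_{ij}(y^{(1)})\big)\tfrac{y_j^{(2)}}{\rho_j}-\sum_j\big(\beta_{20}d_{ij}(y^n)+\beta_{21}d_{ij}(y^{(1)})\big)\tfrac{y_i^{(2)}}{\rho_i}\Big),\\ a_i&=\eta_1y_i^n+\eta_2y_i^{(1)}+\Delta t\Big(\sum_j\big(\eta_3p_{ij}(y^n)+\eta_4p_{ij}(y^{(1)})\big)\tfrac{a_j}{(y_j^n)^{1-s}(y_j^{(1)})^s}-\sum_j\big(\eta_3d_{ij}(y^n)+\eta_4d_{ij}(y^{(1)})\big)\tfrac{a_i}{(y_i^n)^{1-s}(y_i^{(1)})^s}\Big),\\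 \sigma_i&=a_i+\zeta y_i^n\tfrac{y_i^{(2)}}{\rho_i},\\ y_i^{n+1}&=\alpha_{30}y_i^n+\alpha_{31}y_i^{(1)}+\alpha_{32}y_i^{(2)}+\Delta t\Big(\sum_j\big(\beta_{30}p_{ij}(y^n)+\beta_{31}p_{ij}(y^{(1)})+\beta_{32}p_{ij}(y^{(2)})\big)\tfrac{y_j^{n+1}}{\sigma_j}\\ &\qquad-\sum_j\big(\beta_{30}d_{ij}(y^n)+\beta_{31}d_{ij}(y^{(1)})+\beta_{32}d_{ij}(y^{(2)})\big)\tfrac{y_i^{n+1}}{\sigma_i}\Big), \end{aligned}$$ with the parameters $\alpha_{21}=0.073996874459681783$, $\alpha_{20}=1-\alpha_{21}$, $\alpha_{31}=2.0662904223744017\cdot10^{-10}$, $\alpha_{32}=0.29560959605909481$, $\alpha_{30}=1-\alpha_{31}-\alpha_{32}$, $\beta_{10}=0.47620819268131703$, $\beta_{20}=0.077545442722396801$, $\beta_{21}=0.59197500149679749$, $\beta_{30}=0.20044747790361456$, $\beta_{31}=6.8214380786704851\cdot10^{-10}$, $\beta_{32}=0.59121918658514827$, $\zeta=0.62889380778287493358$,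 $\eta_1=0.37110619221712506642-\eta_2$, $\eta_3=-1.2832127371313151768\,\eta_2+0.6146025595987523739$, $\eta_4=2.2248760403511226405$, $n_1=0.25690460257320105191$, $n_2=1-n_1$. The exponent $s$ may be any real number in $[5.6,5.75]$; the value of $s$ that belongs to the scheme depends on $\eta_2$ and lies in this interval for every $\eta_2\in[0,r_1]$. -/

import Mathlib

open Filter Topology Matrix

namespace SSPMPRK3

/-! The numerical parameters of the third order scheme. -/

noncomputable section

/-- `α₂₁` -/
def α21 : ℝ := 0.073996874459681783

/-- `α₂₀ = 0.92600312554031822…`, fixed by `α₂₀ + α₂₁ = 1`. -/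
def α20 : ℝ := 1 - α21

/-- `α₃₁` -/
def α31 : ℝ := 0.00000000020662904223744017

/-- `α₃₂` -/
def α32 : ℝ := 0.29560959605909481

/-- `α₃₀ = 0.70439040373427615…`, fixed by `α₃₀ + α₃₁ + α₃₂ = 1`. -/
def α30 : ℝ := 1 - α31 - α32

/-- `β₁₀` -/
def β10 : ℝ := 0.47620819268131703

/-- `β₂₀` -/
def β20 : ℝ := 0.077545442722396801

/-- `β₂₁` -/
def β21 : ℝ := 0.59197500149679749

/-- `β₃₀` -/
def β30 : ℝ := 0.20044747790361456

/-- `β₃₁` -/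
def β31 : ℝ := 0.00000000068214380786704851

/-- `β₃₂` -/
def β32 : ℝ := 0.59121918658514827

/-- `ζ` -/
def ζ : ℝ := 0.62889380778287493358

/-- `n₁` -/
def n1 : ℝ := 0.25690460257320105191

/-- `n₂ = 1 - n₁` -/
def n2 : ℝ := 1 - n1

/-- `η₁`, as a function of the free parameter `η₂`. -/
def η1 (η2 : ℝ) : ℝ := 0.37110619221712506642 - η2

/-- `η₃`, as a function of the free parameter `η₂`. -/
def η3 (η2 : ℝ) : ℝ := -1.2832127371313151768 * η2 + 0.6146025595987523739

/-- `η₄` -/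
def η4 : ℝ := 2.2248760403511226405

/-- The upper end `r₁` of the range of the free parameter `η₂`. -/
def r1 : ℝ := 0.37110619221712509

variable {ι : Type*} [Fintype ι]

/-- The weighted production minus destruction
`∑ⱼ P i j * w j - ∑ⱼ D i j * w i`, where `D i j = P j i` (conservativity of the PDS). -/
def weightedRate (P : Matrix ι ι ℝ) (w : ι → ℝ) (i : ι) : ℝ :=
  ∑ j, P i j * w j - ∑ j, P j i * w i

/-- One step `y ↦ y'` of the scheme with free parameter `η2`, exponent `s` and step size `Δt`,
for the conservative production-destruction system with production terms `p y i j`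
and destruction terms `d y i j = p y j i`. All stages are given implicitly. -/
def IsStep (p : (ι → ℝ) → Matrix ι ι ℝ) (η2 s Δt : ℝ) (y y' : ι → ℝ) : Prop :=
  ∃ y1 ρ y2 a σ : ι → ℝ,
    (∀ i, y1 i = y i + β10 * Δt * weightedRate (p y) (fun j => y1 j / y j) i) ∧
    (∀ i, ρ i = n1 * y1 i + n2 * y i * (y1 i / y i) ^ 2) ∧
    (∀ i, y2 i = α20 * y i + α21 * y1 i
      + Δt * weightedRate (β20 • p y + β21 • p y1) (fun j => y2 j / ρ j) i) ∧
    (∀ i, a i = η1 η2 * y i + η2 * y1 i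
      + Δt * weightedRate (η3 η2 • p y + η4 • p y1)
          (fun j => a j / (y j ^ (1 - s) * y1 j ^ s)) i) ∧
    (∀ i, σ i = a i + ζ * y i * (y2 i / ρ i)) ∧
    (∀ i, y' i = α30 * y i + α31 * y1 i + α32 * y2 i
      + Δt * weightedRate (β30 • p y + β31 • p y1 + β32 • p y2) (fun j => y' j / σ j) i)

/-- `Y 0, Y 1, Y 2, …` are iterates of the scheme with starting value `z`. -/
def IsIterates (p : (ι → ℝ) → Matrix ι ι ℝ) (η2 s Δt : ℝ) (z : ι → ℝ) (Y : ℕ → ι → ℝ) : Prop :=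
  Y 0 = z ∧ ∀ n, IsStep p η2 s Δt (Y n) (Y (n + 1))

/-- The production terms of `y' = A y` written as a production-destruction system:
`p i j (y) = A i j * y j` for `i ≠ j`, and `p i i = 0`. -/
def linearProduction [DecidableEq ι] (A : Matrix ι ι ℝ) (y : ι → ℝ) : Matrix ι ι ℝ :=
  Matrix.of fun i j => if i = j then 0 else A i j * y j

/-- `x` and `y` have the same linear invariants with respect to `y' = A y`:
`nᵀ x = nᵀ y` for all `n` in the kernel of `Aᵀ`. -/
def SameInvariants (A : Matrix ι ι ℝ) (x y : ι → ℝ) : Prop :=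
  ∀ n : ι → ℝ, Aᵀ *ᵥ n = 0 → n ⬝ᵥ x = n ⬝ᵥ y

/-- `ystar` is a steady state of the initial value problem `y' = A y`, `y 0 = y0`: it is an
equilibrium of the system, and it has the linear invariants of `y0`. -/
def IsSteadyState (A : Matrix ι ι ℝ) (y0 ystar : ι → ℝ) : Prop :=
  A *ᵥ ystar = 0 ∧ SameInvariants A ystar y0

end

end SSPMPRK3

/-! Put B = Δt·A. Given the earlier stages, each stage solves a linear system x = b + B(Dx) with D
diagonal. At the positive equilibrium every D is a scalar matrix and y* is fixed by the step. Near
y* the systems stay uniquely solvable, so the implicit scheme coincides with a map `stepMap` that is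
differentiable at y*. Its derivative `linStep` is a rational function of B, hence acts on an
eigenvector of B with eigenvalue z as a scalar R(z), a quotient of two quartics whose coefficients
depend on η2 and s.

Two facts carry the proof. First, A·diag(y*) has vanishing row and column sums, so its quadratic
form is dissipative; consequently the eigenvalues of A on the subspace annihilated by ker Aᵀ have
strictly negative real part (`re_lt_zero_of_mulVec_eq_smul`). Second, |R(z)| < 1 whenever Re z < 0,
for all admissible η2 and s (`norm_stability_lt_one`).

Together they make the spectral radius of the derivative on that subspace less than one, so a power
of it contracts there (`exists_pow_linStep_contraction`). The derivative may have eigenvalue 1 in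
other directions, but each step preserves the linear invariants, so the errors never leave the
subspace. `exists_forall_tendsto_iterate` then yields convergence and confinement to a neighbourhood
of y* on which vectors are positive and the step is single-valued.

Uniqueness of the steady state follows from the same dissipation argument, applied to the difference
of two equilibria with equal invariants. -/

namespace SSPMPRK3

/-! ### The stability function on the open left half plane -/

theorem normSq_quartic (p1 p2 p3 p4 : ℝ) (z : ℂ) :
    Complex.normSq (1 + p1 * z + p2 * z ^ 2 + p3 * z ^ 3 + p4 * z ^ 4) =
      (1 + p1 * z.re + p2 * (z.re ^ 2 - z.im ^ 2) + p3 * (z.re ^ 3 - 3 * z.re * z.im ^ 2)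
        + p4 * (z.re ^ 4 - 6 * z.re ^ 2 * z.im ^ 2 + z.im ^ 4)) ^ 2
      + (p1 * z.im + p2 * (2 * z.re * z.im) + p3 * (3 * z.re ^ 2 * z.im - z.im ^ 3)
        + p4 * (4 * z.re ^ 3 * z.im - 4 * z.re * z.im ^ 3)) ^ 2 := by
  simp only [Complex.normSq_apply, pow_succ, pow_zero, one_mul, Complex.add_re, Complex.add_im,
    Complex.mul_re, Complex.mul_im, Complex.ofReal_re, Complex.ofReal_im, Complex.one_re,
    Complex.one_im]
  ring

/-- Sufficient conditions on the coefficients of two quartics for `|P| < |Q|` on the open left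
half plane: every coefficient of `|Q|² - |P|²`, as a polynomial in `-Re z` and `(Im z)²`, is
nonnegative. -/
theorem normSq_quartic_lt {c1 c2 c3 c4 d1 d2 d3 d4 : ℝ} (h10 : d1 < c1)
    (h01 : c1 ^ 2 - 2 * c2 ≤ d1 ^ 2 - 2 * d2)
    (h02 : 2 * c4 - 2 * c1 * c3 + c2 ^ 2 ≤ 2 * d4 - 2 * d1 * d3 + d2 ^ 2)
    (h03 : c3 ^ 2 - 2 * c2 * c4 ≤ d3 ^ 2 - 2 * d2 * d4)
    (h04 : c4 ^ 2 ≤ d4 ^ 2)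
    (h11 : 3 * c3 - c1 * c2 ≤ 3 * d3 - d1 * d2)
    (h12 : 3 * c1 * c4 - c2 * c3 ≤ 3 * d1 * d4 - d2 * d3)
    (h13 : -(c3 * c4) ≤ -(d3 * d4))
    (h20 : 2 * c2 + c1 ^ 2 ≤ 2 * d2 + d1 ^ 2)
    (h21 : c2 ^ 2 - 6 * c4 ≤ d2 ^ 2 - 6 * d4)
    (h30 : -c3 - c1 * c2 ≤ -d3 - d1 * d2)
    (h40 : 2 * c4 + 2 * c1 * c3 + c2 ^ 2 ≤ 2 * d4 + 2 * d1 * d3 + d2 ^ 2)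
    (h50 : -(c1 * c4) - c2 * c3 ≤ -(d1 * d4) - d2 * d3)
    (h60 : 2 * c2 * c4 + c3 ^ 2 ≤ 2 * d2 * d4 + d3 ^ 2)
    {z : ℂ} (hz : z.re < 0) :
    Complex.normSq (1 + c1 * z + c2 * z ^ 2 + c3 * z ^ 3 + c4 * z ^ 4) <
      Complex.normSq (1 + d1 * z + d2 * z ^ 2 + d3 * z ^ 3 + d4 * z ^ 4) := by
  rw [normSq_quartic, normSq_quartic]
  obtain ⟨u, hu⟩ : ∃ u, u = -z.re := ⟨_, rfl⟩
  have hu0 : 0 < u := by linarith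
  have hre : z.re = -u := by linarith
  rw [hre]
  generalize z.im = v
  -- The index of `tij` records the monomial u^i (v²)^j that it governs. The differences are made
  -- opaque so that `positivity` sees nonnegative atoms.
  obtain ⟨t10, e10⟩ : ∃ t, t = c1 - d1 := ⟨_, rfl⟩
  obtain ⟨t01, e01⟩ : ∃ t, t = d1 ^ 2 - 2 * d2 - (c1 ^ 2 - 2 * c2) := ⟨_, rfl⟩
  obtain ⟨t02, e02⟩ : ∃ t, t = 2 * d4 - 2 * d1 * d3 + d2 ^ 2 - (2 * c4 - 2 * c1 * c3 + c2 ^ 2) := ⟨_, rfl⟩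
  obtain ⟨t03, e03⟩ : ∃ t, t = d3 ^ 2 - 2 * d2 * d4 - (c3 ^ 2 - 2 * c2 * c4) := ⟨_, rfl⟩
  obtain ⟨t04, e04⟩ : ∃ t, t = d4 ^ 2 - (c4 ^ 2) := ⟨_, rfl⟩
  obtain ⟨t11, e11⟩ : ∃ t, t = 3 * d3 - d1 * d2 - (3 * c3 - c1 * c2) := ⟨_, rfl⟩
  obtain ⟨t12, e12⟩ : ∃ t, t = 3 * d1 * d4 - d2 * d3 - (3 * c1 * c4 - c2 * c3) := ⟨_, rfl⟩
  obtain ⟨t13, e13⟩ : ∃ t, t = -(d3 * d4) - (-(c3 * c4)) := ⟨_, rfl⟩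
  obtain ⟨t20, e20⟩ : ∃ t, t = 2 * d2 + d1 ^ 2 - (2 * c2 + c1 ^ 2) := ⟨_, rfl⟩
  obtain ⟨t21, e21⟩ : ∃ t, t = d2 ^ 2 - 6 * d4 - (c2 ^ 2 - 6 * c4) := ⟨_, rfl⟩
  obtain ⟨t30, e30⟩ : ∃ t, t = -d3 - d1 * d2 - (-c3 - c1 * c2) := ⟨_, rfl⟩
  obtain ⟨t40, e40⟩ : ∃ t, t = 2 * d4 + 2 * d1 * d3 + d2 ^ 2 - (2 * c4 + 2 * c1 * c3 + c2 ^ 2) := ⟨_, rfl⟩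
  obtain ⟨t50, e50⟩ : ∃ t, t = -(d1 * d4) - d2 * d3 - (-(c1 * c4) - c2 * c3) := ⟨_, rfl⟩
  obtain ⟨t60, e60⟩ : ∃ t, t = 2 * d2 * d4 + d3 ^ 2 - (2 * c2 * c4 + c3 ^ 2) := ⟨_, rfl⟩
  have p10 : 0 < t10 := by linarith
  have p01 : 0 ≤ t01 := by linarith
  have p02 : 0 ≤ t02 := by linarith
  have p03 : 0 ≤ t03 := by linarith
  have p04 : 0 ≤ t04 := by linarith
  have p11 : 0 ≤ t11 := by linarith
  have p12 : 0 ≤ t12 := by linarith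
  have p13 : 0 ≤ t13 := by linarith
  have p20 : 0 ≤ t20 := by linarith
  have p21 : 0 ≤ t21 := by linarith
  have p30 : 0 ≤ t30 := by linarith
  have p40 : 0 ≤ t40 := by linarith
  have p50 : 0 ≤ t50 := by linarith
  have p60 : 0 ≤ t60 := by linarith
  -- The fourteen differences suffice because the coefficients of the other monomials are
  -- nonnegative combinations of them. Strictness comes from the term 2·t10·u alone.
  have key : 0 < 2 * t10 * u + t01 * v ^ 2 + t02 * v ^ 4 + t03 * v ^ 6 + t04 * v ^ 8
      + 2 * t11 * u * v ^ 2 + 2 * t12 * u * v ^ 4 + 2 * t13 * u * v ^ 6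
      + t20 * u ^ 2 + 2 * t21 * u ^ 2 * v ^ 2 + (2 * t03 + t60) * u ^ 2 * v ^ 4
      + 4 * t04 * u ^ 2 * v ^ 6
      + 2 * t30 * u ^ 3 + 2 * (t12 + t50) * u ^ 3 * v ^ 2 + 6 * t13 * u ^ 3 * v ^ 4
      + t40 * u ^ 4 + (t03 + 2 * t60) * u ^ 4 * v ^ 2 + 6 * t04 * u ^ 4 * v ^ 4
      + 2 * t50 * u ^ 5 + 6 * t13 * u ^ 5 * v ^ 2 + t60 * u ^ 6 + 4 * t04 * u ^ 6 * v ^ 2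
      + 2 * t13 * u ^ 7 + t04 * u ^ 8 := by positivity
  rw [← sub_pos]
  convert key using 1
  subst_vars
  ring

/-- The staged form of the stability function of the scheme, written as a quotient of two
quartics. -/
theorem staged_quotient {a20 a21 a30 a31 a32 b10 b20 b21 b2 b30 b31 b32 b3 e1 e2 e3 e4 e κ ζ n1 n2
    s N20 N21 N22 M0 M1 M2 ρ E1 E2 E3 F1 F2 : ℝ}
    (hN20 : N20 = a20 + a21) (hN21 : N21 = b20 + b2 * n2 - a20 * b10 + b21 - b2 * ρ)
    (hN22 : N22 = -b10 * (b20 + b2 * n2)) (hM0 : M0 = e1 + e2)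
    (hM1 : M1 = κ * (e3 + e4 - e) - e1 * b10) (hM2 : M2 = -b10 * κ * (e3 - e * (1 - s)))
    (hρ : ρ = n1 + 2 * n2) (hE1 : E1 = b10 + b2 + e) (hE2 : E2 = b10 * b2 + b10 * e + b2 * e)
    (hE3 : E3 = b10 * b2 * e) (hF1 : F1 = b2 + e) (hF2 : F2 = b2 * e)
    {z l1 l2 la l : ℂ} (h1 : (1 - b10 * z) * l1 = 1)
    (h2 : (1 - b2 * z) * l2 = a20 + a21 * l1
      + z * (b20 + b21 * l1 - b2 * (n1 * l1 + n2 * (2 * l1 - 1))))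
    (ha : (1 - e * z) * la = e1 + e2 * l1
      + z * (κ * (e3 + e4 * l1 - e * ((1 - s) + s * l1))))
    (h3 : (1 - b3 * z) * l = a30 + a31 * l1 + a32 * l2
      + z * (b30 + b31 * l1 + b32 * l2
        - b3 * (la + ζ * (1 + l2 - (n1 * l1 + n2 * (2 * l1 - 1)))))) :
    (1 + ((-(E1 + b3) : ℝ) : ℂ) * z + ((E2 + b3 * E1 : ℝ) : ℂ) * z ^ 2
      + ((-(E3 + b3 * E2) : ℝ) : ℂ) * z ^ 3 + ((b3 * E3 : ℝ) : ℂ) * z ^ 4) * l =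
    ((a30 + a31 + a32 * N20 : ℝ) : ℂ)
      + ((-a30 * E1 + b30 - a31 * F1 + b31 + a32 * (N21 - e * N20) + b32 * N20
        - b3 * (M0 + ζ * (1 + n2 + N20 - ρ)) : ℝ) : ℂ) * z
      + ((a30 * E2 - b30 * E1 + a31 * F2 - b31 * F1 + a32 * (N22 - e * N21)
        + b32 * (N21 - e * N20) - b3 * (M1 - b2 * M0
        + ζ * (-(1 + n2) * E1 + (N21 - e * N20) + ρ * F1)) : ℝ) : ℂ) * z ^ 2
      + ((-a30 * E3 + b30 * E2 + b31 * F2 - a32 * e * N22 + b32 * (N22 - e * N21)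
        - b3 * (M2 - b2 * M1
        + ζ * ((1 + n2) * E2 + (N22 - e * N21) - ρ * F2)) : ℝ) : ℂ) * z ^ 3
      + ((-b30 * E3 - b32 * e * N22
        - b3 * (-b2 * M2 + ζ * (-(1 + n2) * E3 - e * N22)) : ℝ) : ℂ) * z ^ 4 := by
  subst_vars
  push_cast
  -- Elimination in reverse order of the stages: `h3` is multiplied by the remaining three
  -- denominators, then `l2`, `la` and `l1` are removed. N2i and Mi are the numerator coefficients
  -- of `l2` and `la`; Ei and Fi are elementary symmetric functions of the poles' reciprocals.
  linear_combination
    (1 - b10 * z) * (1 - b2 * z) * (1 - e * z) * h3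
    + (1 - b10 * z) * (1 - e * z) * (a32 + b32 * z - b3 * ζ * z) * h2
    - (1 - b10 * z) * (1 - b2 * z) * b3 * z * ha
    + ((1 - b2 * z) * (1 - e * z) * (a31 + b31 * z + b3 * ζ * z * (n1 + 2 * n2))
      + (1 - e * z) * (a32 + b32 * z - b3 * ζ * z) * (a21 + z * (b21 - b2 * (n1 + 2 * n2)))
      - (1 - b2 * z) * b3 * z * (e2 + z * κ * (e4 - e * s))) * h1

/-- The Bernstein polynomials of bidegree `(2, 2)` are nonnegative on their rectangle. -/
theorem bernstein_nonneg {a b c d x y : ℝ} (hx : x ∈ Set.Icc a b) (hy : y ∈ Set.Icc c d) :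
    (0 ≤ (x - a) ^ 2 * (y - c) ^ 2 ∧ 0 ≤ (x - a) ^ 2 * ((y - c) * (d - y)) ∧
      0 ≤ (x - a) ^ 2 * (d - y) ^ 2) ∧
    (0 ≤ (x - a) * (b - x) * (y - c) ^ 2 ∧ 0 ≤ (x - a) * (b - x) * ((y - c) * (d - y)) ∧
      0 ≤ (x - a) * (b - x) * (d - y) ^ 2) ∧
    (0 ≤ (b - x) ^ 2 * (y - c) ^ 2 ∧ 0 ≤ (b - x) ^ 2 * ((y - c) * (d - y)) ∧
      0 ≤ (b - x) ^ 2 * (d - y) ^ 2) := by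
  have h1 : 0 ≤ x - a := sub_nonneg.2 hx.1
  have h2 : 0 ≤ b - x := sub_nonneg.2 hx.2
  have h3 : 0 ≤ y - c := sub_nonneg.2 hy.1
  have h4 : 0 ≤ d - y := sub_nonneg.2 hy.2
  refine ⟨⟨?_, ?_, ?_⟩, ⟨?_, ?_, ?_⟩, ⟨?_, ?_, ?_⟩⟩ <;> positivity

/-- The decimals are the coefficients from `staged_quotient` with the parameters of the scheme
inserted. Each condition of `normSq_quartic_lt` is then a polynomial inequality of degree at most
two in h and in s separately, for which `linarith` finds a certificate from the Bernstein products
and the interval bounds. -/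
theorem normSq_num_lt_normSq_den {h s : ℝ} (hh : h ∈ Set.Icc 0 r1) (hs : s ∈ Set.Icc (5.6 : ℝ) 5.75)
    {z : ℂ} (hz : z.re < 0) {c1 c2 c3 c4 d1 d2 d3 d4 : ℝ}
    (hc1 : c1 =
      -3.7768739020212929169947837134550664665836002783097031 + 1.2832127371313151768 * h)
    (hc2 : c2 =
      2.45018488772457329271592450820553523515113602555621274674051411914376807946890149166 - 1.20287759134510016608665989567747919893554998433703706116597192117200808 * h)
    (hc3 : c3 =
      -1.455616486251869703463390321024089046437957316145674508484024522384754339549939163755495317082723979904 + 0.3972610828395645932132903949864522928400881558141562626499640780245069814137449344 * s + 0.619511853079054575397669601053527533268451677051209878127262621811514503117066293843150170899116625488 * h - 0.1795296085257718589308906271654929736130035092716953219242667824949473691677389168 * h * s)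
    (hc4 : c4 =
      0.885190618289737295750154964110131321127562862318806082160850492774436075247881100039045083691570567 - 0.2659744166537434286097521997103555129932792080142425821459660758577872143352807445977748721506495104 * s - 0.305852128012208884573757130519265629145748702456599881819487165900293509435359025609114175558441168 * h + 0.1201987432506728256884293758613879061923439657177275811627792130476750034456476697190528511410839888 * h * s)
    (hd1 : d1 = -4.77687390202129297326704851 + 1.2832127371313151768 * h)
    (hd2 : d2 = 6.727058789745866463365838275225626367232930254 - 2.486090328476415415091736393124193472784826568 * h)
    (hd3 : d3 = -3.733229066568748645616921434365151856021590864510930438240928924 + 1.573047237181928819263737114661467880579944426356887784705576328 * h)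
    (hd4 : d4 = 0.71670702950202557446264328925725775280119779292236269208394310606310513734523712 - 0.32389312216150656420772167859845448779194889463486396980931752266521616433199464 * h)
    : Complex.normSq (1 + c1 * z + c2 * z ^ 2 + c3 * z ^ 3 + c4 * z ^ 4) <
      Complex.normSq (1 + d1 * z + d2 * z ^ 2 + d3 * z ^ 3 + d4 * z ^ 4) := by
  rw [r1] at hh
  obtain ⟨⟨b1, b2, b3⟩, ⟨b4, b5, b6⟩, ⟨b7, b8, b9⟩⟩ := bernstein_nonneg hh hs
  have hh0 := hh.1
  have hh1 := hh.2
  have hs0 := hs.1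
  have hs1 := hs.2
  norm_num at b1 b2 b3 b4 b5 b6 b7 b8 b9 hh0 hh1 hs0 hs1
  subst hc1 hc2 hc3 hc4 hd1 hd2 hd3 hd4
  refine normSq_quartic_lt ?_ ?_ ?_ ?_ ?_ ?_ ?_ ?_ ?_ ?_ ?_ ?_ ?_ ?_ hz <;> linarith

theorem norm_lt_one_of_mul_eq {P Q l : ℂ} (h : Q * l = P)
    (hlt : Complex.normSq P < Complex.normSq Q) : ‖l‖ < 1 := by
  rw [← h, Complex.normSq_mul] at hlt
  have h1 : Complex.normSq l < 1 := by
    by_contra! hl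
    nlinarith [Complex.normSq_nonneg Q]
  rw [Complex.normSq_eq_norm_sq] at h1
  nlinarith [norm_nonneg l]

/-- The stability function of the scheme is less than one in modulus on the open left half
plane. -/
theorem norm_stability_lt_one {h s : ℝ} (hh : h ∈ Set.Icc 0 r1)
    (hs : s ∈ Set.Icc (5.6 : ℝ) 5.75) {z : ℂ} (hz : z.re < 0) {l1 l2 la l : ℂ}
    (h1 : (1 - β10 * z) * l1 = 1)
    (h2 : (1 - (β20 + β21 : ℝ) * z) * l2 = α20 + α21 * l1
      + z * (β20 + β21 * l1 - (β20 + β21 : ℝ) * (n1 * l1 + n2 * (2 * l1 - 1))))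
    (ha : (1 - (η3 h + η4 : ℝ) * z) * la = η1 h + h * l1
      + z * ((η1 h + h : ℝ) * (η3 h + η4 * l1 - (η3 h + η4 : ℝ) * ((1 - s) + s * l1))))
    (h3 : (1 - (β30 + β31 + β32 : ℝ) * z) * l = α30 + α31 * l1 + α32 * l2
      + z * (β30 + β31 * l1 + β32 * l2
        - (β30 + β31 + β32 : ℝ) * (la + ζ * (1 + l2 - (n1 * l1 + n2 * (2 * l1 - 1)))))) :
    ‖l‖ < 1 := by
  have key := staged_quotient rfl rfl rfl rfl rfl rfl rfl rfl rfl rfl rfl rfl h1 h2 ha h3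
  -- Convexity of the α's normalizes the constant term of the numerator to 1.
  rw [show α30 + α31 + α32 * (α20 + α21) = 1 by unfold α30 α20; ring, Complex.ofReal_one] at key
  refine norm_lt_one_of_mul_eq key (normSq_num_lt_normSq_den hh hs hz ?_ ?_ ?_ ?_ ?_ ?_ ?_ ?_)
  all_goals
    simp only [α30, α20, α21, α31, α32, η1, η3, β10, β20, β21, β30, β31, β32, n2, n1, ζ, η4]
    norm_num
    ring

/-! ### Spectrum of a conservative Metzler matrix with a positive equilibrium -/

section Dissipation

variable {ι : Type*} [Fintype ι]

/-- The dissipation identity for a matrix with vanishing row and column sums. -/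
theorem re_sum_conj_mul_mul {B : Matrix ι ι ℝ} (hrow : ∀ i, ∑ j, B i j = 0)
    (hcol : ∀ j, ∑ i, B i j = 0) (n : ι → ℂ) :
    (∑ i, ∑ j, star (n i) * B i j * n j).re =
      -(1 / 2) * ∑ i, ∑ j, B i j * Complex.normSq (n i - n j) := by
  have h1 : ∑ i, ∑ j, B i j * Complex.normSq (n i) = 0 := by
    simp_rw [← Finset.sum_mul, hrow, zero_mul, Finset.sum_const_zero]
  have h2 : ∑ i, ∑ j, B i j * Complex.normSq (n j) = 0 := by
    rw [Finset.sum_comm]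
    simp_rw [← Finset.sum_mul, hcol, zero_mul, Finset.sum_const_zero]
  have h3 : ∑ i, ∑ j, B i j * Complex.normSq (n i - n j) =
      ∑ i, ∑ j, B i j * Complex.normSq (n i) + ∑ i, ∑ j, B i j * Complex.normSq (n j)
        - 2 * (∑ i, ∑ j, star (n i) * B i j * n j).re := by
    rw [Complex.re_sum, Finset.mul_sum, ← Finset.sum_add_distrib, ← Finset.sum_sub_distrib]
    refine Finset.sum_congr rfl fun i _ => ?_
    rw [Complex.re_sum, Finset.mul_sum, ← Finset.sum_add_distrib, ← Finset.sum_sub_distrib]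
    refine Finset.sum_congr rfl fun j _ => ?_
    simp [Complex.normSq_apply]
    ring
  rw [h3, h1, h2]
  ring

variable {A : Matrix ι ι ℝ} {y : ι → ℝ}

theorem sum_col_eq_zero (hcons : Aᵀ *ᵥ (fun _ => (1 : ℝ)) = 0) (j : ι) : ∑ i, A i j = 0 := by
  simpa [mulVec, dotProduct] using congrFun hcons j

variable [DecidableEq ι]

/-- For a conservative Metzler matrix with a positive equilibrium `y`, an eigenvector with
eigenvalue of nonnegative real part lies in the kernel, and its quotient by `y` is a (complex
conjugated) linear invariant. -/
theorem mulVec_eq_zero_of_re_nonneg (hM : ∀ i j, i ≠ j → 0 ≤ A i j)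
    (hcons : Aᵀ *ᵥ (fun _ => (1 : ℝ)) = 0) (hy : ∀ i, 0 < y i) (hAy : A *ᵥ y = 0)
    {μ : ℂ} (hμ : 0 ≤ μ.re) {v : ι → ℂ} (hv : Complex.ofRealHom.mapMatrix A *ᵥ v = μ • v) :
    Complex.ofRealHom.mapMatrix A *ᵥ v = 0 ∧
      (Complex.ofRealHom.mapMatrix A)ᵀ *ᵥ (fun i => star (v i / y i)) = 0 := by
  have hyC : ∀ i, (y i : ℂ) ≠ 0 := fun i => by exact_mod_cast (hy i).ne'
  obtain ⟨n, hn⟩ : ∃ n : ι → ℂ, ∀ i, n i = v i / y i := ⟨_, fun _ => rfl⟩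
  have hvn : ∀ i, v i = y i * n i := fun i => by rw [hn, mul_div_cancel₀ _ (hyC i)]
  -- Scaling the columns by y turns the equilibrium equation into vanishing row sums and keeps the
  -- column sums zero.
  obtain ⟨B, hB⟩ : ∃ B : Matrix ι ι ℝ, ∀ i j, B i j = A i j * y j := ⟨fun i j => A i j * y j,
    fun _ _ => rfl⟩
  have hrow : ∀ i, ∑ j, B i j = 0 := fun i => by
    simpa [mulVec, dotProduct, hB] using congrFun hAy i
  have hcol : ∀ j, ∑ i, B i j = 0 := fun j => by
    simp_rw [hB, ← Finset.sum_mul, sum_col_eq_zero hcons, zero_mul]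
  have hAv : ∀ i, (Complex.ofRealHom.mapMatrix A *ᵥ v) i = ∑ j, (B i j : ℂ) * n j := fun i => by
    simp [mulVec, dotProduct, hB, hvn, mul_assoc]
  have hnonneg : ∀ i j, 0 ≤ B i j * Complex.normSq (n i - n j) := fun i j => by
    by_cases hij : i = j
    · simp [hij]
    · rw [hB]
      exact mul_nonneg (mul_nonneg (hM i j hij) (hy j).le) (Complex.normSq_nonneg _)
  -- The form equals μ Σ yᵢ|nᵢ|², while the dissipation identity makes its real part nonpositive.
  -- Hence every term B i j |nᵢ - nⱼ|² vanishes.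
  have hre : 0 ≤ (∑ i, ∑ j, star (n i) * B i j * n j).re := by
    have : ∑ i, ∑ j, star (n i) * B i j * n j = μ * ((∑ i, y i * Complex.normSq (n i) : ℝ) : ℂ) := by
      push_cast
      rw [Finset.mul_sum]
      refine Finset.sum_congr rfl fun i _ => ?_
      simp_rw [mul_assoc]
      rw [← Finset.mul_sum, ← hAv, hv, Pi.smul_apply, hvn, smul_eq_mul, Complex.normSq_eq_conj_mul_self]
      simp only [Complex.star_def]
      ring
    rw [this, Complex.re_mul_ofReal]
    exact mul_nonneg hμ (Finset.sum_nonneg fun i _ =>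
      mul_nonneg (hy i).le (Complex.normSq_nonneg _))
  have hsum : ∑ i, ∑ j, B i j * Complex.normSq (n i - n j) = 0 := by
    refine le_antisymm ?_ (Finset.sum_nonneg fun i _ => Finset.sum_nonneg fun j _ => hnonneg i j)
    rw [re_sum_conj_mul_mul hrow hcol] at hre
    linarith
  have hz : ∀ i j, (B i j : ℂ) * (n j - n i) = 0 := fun i j => by
    rw [Finset.sum_eq_zero_iff_of_nonneg fun i _ => Finset.sum_nonneg fun j _ => hnonneg i j] at hsum
    have h1 := hsum i (Finset.mem_univ i)
    rw [Finset.sum_eq_zero_iff_of_nonneg fun j _ => hnonneg i j] at h1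
    rcases mul_eq_zero.1 (h1 j (Finset.mem_univ j)) with h | h
    · simp [h]
    · rw [Complex.normSq_eq_zero, sub_eq_zero] at h
      simp [h]
  constructor
  · ext i
    rw [hAv, Pi.zero_apply]
    have h1 : ∑ j, (B i j : ℂ) * n j = ∑ j, (B i j : ℂ) * n i := Finset.sum_congr rfl fun j _ => by
      linear_combination hz i j
    rw [h1, ← Finset.sum_mul, ← Complex.ofReal_sum, hrow, Complex.ofReal_zero, zero_mul]
  · ext j
    have h1 : ∀ i, (A i j : ℂ) * star (n i) = A i j * star (n j) := fun i => by
      have h2 : (A i j : ℂ) * (n j - n i) = 0 := by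
        have h3 := hz i j
        rw [hB, Complex.ofReal_mul, mul_right_comm] at h3
        exact (mul_eq_zero.1 h3).resolve_right (hyC j)
      have h4 := congrArg star h2
      simp only [star_mul', star_sub, star_zero, Complex.star_def, Complex.conj_ofReal] at h4
      simp only [Complex.star_def]
      linear_combination -h4
    simp only [mulVec, dotProduct, transpose_apply, RingHom.mapMatrix_apply, map_apply,
      Complex.ofRealHom_eq_coe, ← hn, Pi.zero_apply]
    rw [Finset.sum_congr rfl fun i _ => h1 i, ← Finset.sum_mul, ← Complex.ofReal_sum,
      sum_col_eq_zero hcons, Complex.ofReal_zero, zero_mul]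

/-- The eigenvalues on the complement of the linear invariants have negative real part. -/
theorem re_lt_zero_of_mulVec_eq_smul (hM : ∀ i j, i ≠ j → 0 ≤ A i j)
    (hcons : Aᵀ *ᵥ (fun _ => (1 : ℝ)) = 0) (hy : ∀ i, 0 < y i) (hAy : A *ᵥ y = 0)
    {μ : ℂ} {v : ι → ℂ} (hv0 : v ≠ 0)
    (hv : Complex.ofRealHom.mapMatrix A *ᵥ v = μ • v)
    (hV : ∀ n : ι → ℂ, (Complex.ofRealHom.mapMatrix A)ᵀ *ᵥ n = 0 → n ⬝ᵥ v = 0) : μ.re < 0 := by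
  by_contra! hμ
  -- Pairing v with the invariant conj(v/y) gives Σ |vᵢ|²/yᵢ = 0.
  have h1 := hV _ (mulVec_eq_zero_of_re_nonneg hM hcons hy hAy hμ hv).2
  refine hv0 (funext fun i => ?_)
  have h2 : ∑ i, Complex.normSq (v i) / y i = 0 := by
    have : ((∑ i, Complex.normSq (v i) / y i : ℝ) : ℂ) = 0 := by
      rw [← h1, dotProduct, Complex.ofReal_sum]
      refine Finset.sum_congr rfl fun i _ => ?_
      rw [Complex.ofReal_div, Complex.normSq_eq_conj_mul_self]
      simp only [Complex.star_def, map_div₀, Complex.conj_ofReal]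
      ring
    exact_mod_cast this
  rw [Finset.sum_eq_zero_iff_of_nonneg fun i _ => div_nonneg (Complex.normSq_nonneg _) (hy i).le] at h2
  have h3 := h2 i (Finset.mem_univ i)
  rwa [div_eq_zero_iff, or_iff_left (hy i).ne', Complex.normSq_eq_zero] at h3

theorem mapMatrix_mulVec_ofReal (A : Matrix ι ι ℝ) (v : ι → ℝ) :
    Complex.ofRealHom.mapMatrix A *ᵥ (fun i => (v i : ℂ)) = fun i => ((A *ᵥ v) i : ℂ) :=
  funext fun i => (RingHom.map_mulVec Complex.ofRealHom A v i).symm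

/-- An equilibrium without linear invariants vanishes. -/
theorem eq_zero_of_mulVec_eq_zero (hM : ∀ i j, i ≠ j → 0 ≤ A i j)
    (hcons : Aᵀ *ᵥ (fun _ => (1 : ℝ)) = 0) (hy : ∀ i, 0 < y i) (hAy : A *ᵥ y = 0)
    {v : ι → ℝ} (hv : A *ᵥ v = 0) (hV : ∀ n, Aᵀ *ᵥ n = 0 → n ⬝ᵥ v = 0) : v = 0 := by
  have hvC : Complex.ofRealHom.mapMatrix A *ᵥ (fun i => (v i : ℂ)) = (0 : ℂ) • fun i => (v i : ℂ) := by
    rw [mapMatrix_mulVec_ofReal, hv]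
    ext i
    simp
  have h1 := (mulVec_eq_zero_of_re_nonneg hM hcons hy hAy le_rfl hvC).2
  have h2 : Aᵀ *ᵥ (fun i => v i / y i) = 0 := by
    ext i
    have := congrFun h1 i
    simp only [mulVec, dotProduct, transpose_apply, RingHom.mapMatrix_apply, map_apply,
      Complex.ofRealHom_eq_coe, Complex.star_def, map_div₀, Complex.conj_ofReal, Pi.zero_apply]
      at this ⊢
    exact_mod_cast this
  have h3 := hV _ h2
  rw [dotProduct, Finset.sum_eq_zero_iff_of_nonneg fun i _ => by
    rw [div_mul_eq_mul_div]; exact div_nonneg (mul_self_nonneg _) (hy i).le] at h3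
  ext i
  have h4 := h3 i (Finset.mem_univ i)
  rw [div_mul_eq_mul_div, div_eq_zero_iff, or_iff_left (hy i).ne'] at h4
  exact mul_self_eq_zero.1 h4

/-- A kernel vector v would be an eigenvector of A with eigenvalue 1/c > 0, hence Av = 0 by
dissipation, and then v = c·Av = 0. This makes every stage solvable at the equilibrium, for any step
size. -/
theorem det_one_sub_smul_ne_zero (hM : ∀ i j, i ≠ j → 0 ≤ A i j)
    (hcons : Aᵀ *ᵥ (fun _ => (1 : ℝ)) = 0) (hy : ∀ i, 0 < y i) (hAy : A *ᵥ y = 0)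
    {c : ℝ} (hc : 0 < c) : (1 - c • A).det ≠ 0 := by
  intro hdet
  obtain ⟨v, hv0, hv⟩ := exists_mulVec_eq_zero_iff.2 hdet
  rw [sub_mulVec, one_mulVec, smul_mulVec, sub_eq_zero] at hv
  have hAv : A *ᵥ v = c⁻¹ • v := by
    rw [eq_inv_smul_iff₀ hc.ne']
    exact hv.symm
  have hvC : Complex.ofRealHom.mapMatrix A *ᵥ (fun i => (v i : ℂ)) =
      ((c⁻¹ : ℝ) : ℂ) • fun i => (v i : ℂ) := by
    rw [mapMatrix_mulVec_ofReal, hAv]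
    ext i
    simp
  have h1 := (mulVec_eq_zero_of_re_nonneg hM hcons hy hAy (μ := ((c⁻¹ : ℝ) : ℂ))
    (by simpa using hc.le) hvC).1
  rw [mapMatrix_mulVec_ofReal] at h1
  refine hv0 ?_
  rw [hv]
  ext i
  have := congrFun h1 i
  simp only [Pi.zero_apply] at this
  rw [Pi.smul_apply, show (A *ᵥ v) i = 0 by exact_mod_cast this, smul_zero, Pi.zero_apply]

end Dissipation

/-! ### From eigenvalues of modulus less than one to a contracting power -/

section Contraction

/-- In finite dimension the spectrum consists of eigenvalues, so the spectral radius is below one,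
and Gelfand's formula bounds ‖T^k‖^(1/k) for large k. -/
theorem exists_pow_norm_lt_one {V : Type*} [NormedAddCommGroup V] [NormedSpace ℂ V]
    [FiniteDimensional ℂ V] (T : V →L[ℂ] V)
    (h : ∀ (μ : ℂ) (v : V), v ≠ 0 → T v = μ • v → ‖μ‖ < 1) : ∃ k, 0 < k ∧ ‖T ^ k‖ < 1 := by
  rcases subsingleton_or_nontrivial V with hV | hV
  · refine ⟨1, one_pos, ?_⟩
    have : T ^ 1 = 0 := by ext v; exact Subsingleton.elim _ _
    rw [this, norm_zero]
    exact one_pos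
  have : CompleteSpace V := FiniteDimensional.complete ℂ V
  have hr : spectralRadius ℂ T < 1 := by
    refine spectrum.spectralRadius_lt_of_forall_lt T (r := 1) fun μ hμ => ?_
    have h1 : μ ∈ spectrum ℂ (T : V →ₗ[ℂ] V) := by
      have := AlgEquiv.spectrum_eq (Module.End.toContinuousLinearMap (𝕜 := ℂ) V).symm T
      rw [← this] at hμ
      exact hμ
    rw [← Module.End.hasEigenvalue_iff_mem_spectrum] at h1
    obtain ⟨v, hv⟩ := h1.exists_hasEigenvector
    exact h μ v hv.2 hv.apply_eq_smul
  have hev := (spectrum.pow_nnnorm_pow_one_div_tendsto_nhds_spectralRadius T).eventually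
    (gt_mem_nhds hr)
  obtain ⟨k, hk1, hk⟩ := (hev.and (eventually_gt_atTop 0)).exists
  refine ⟨k, hk, ?_⟩
  have hk' : (0 : ℝ) < 1 / k := by positivity
  by_contra! hle
  exact hk1.not_ge (ENNReal.one_le_rpow (by exact_mod_cast hle) hk')

/-- If `T` commutes with `S`, and acts on each eigenvector of `S` as a scalar of modulus less than
one, then some power of `T` is a contraction. -/
theorem exists_pow_norm_lt_one_of_commute {V : Type*} [NormedAddCommGroup V] [NormedSpace ℂ V]
    [FiniteDimensional ℂ V] (S T : V →ₗ[ℂ] V) (hST : Commute S T)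
    (h : ∀ (μ : ℂ) (v : V), v ≠ 0 → S v = μ • v → ∃ ν : ℂ, ‖ν‖ < 1 ∧ T v = ν • v) :
    ∃ k, 0 < k ∧ ‖T.toContinuousLinearMap ^ k‖ < 1 := by
  refine exists_pow_norm_lt_one _ fun μ v hv hTv => ?_
  -- S preserves this eigenspace and so has an eigenvector in it. There T acts both as μ and as a
  -- scalar of modulus less than one.
  set W := Module.End.eigenspace T μ
  have hmaps : ∀ x ∈ W, S x ∈ W := fun x hx => by
    rw [Module.End.mem_eigenspace_iff] at hx ⊢
    have := congrArg (fun f : V →ₗ[ℂ] V => f x) hST.eq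
    simp only [Module.End.mul_apply] at this
    rw [← this, hx, map_smul]
  have hvW : v ∈ W := Module.End.mem_eigenspace_iff.2 hTv
  have : Nontrivial W := ⟨⟨v, hvW⟩, 0, fun e => hv (congrArg Subtype.val e)⟩
  obtain ⟨ν, hν⟩ := Module.End.exists_eigenvalue (S.restrict hmaps)
  obtain ⟨w, hw⟩ := hν.exists_hasEigenvector
  have hw0 : (w : V) ≠ 0 := fun e => hw.2 (Subtype.ext e)
  obtain ⟨κ, hκ, hTw⟩ := h ν w hw0 (congrArg Subtype.val hw.apply_eq_smul)
  have hTw' := Module.End.mem_eigenspace_iff.1 w.2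
  rw [hTw] at hTw'
  rwa [← smul_left_injective ℂ hw0 hTw']

variable {ι : Type*} [Fintype ι] [DecidableEq ι]

/-- If `L` commutes with `A`, and acts on each complex eigenvector of `A` that is orthogonal to the
kernel of `Aᵀ` as a scalar of modulus less than one, then some power of `L` contracts the vectors
without linear invariants. -/
theorem exists_pow_mulVec_contraction {A L : Matrix ι ι ℝ} (hAL : Commute A L)
    (h : ∀ (μ : ℂ) (v : ι → ℂ), v ≠ 0 →
      (∀ n : ι → ℂ, (Complex.ofRealHom.mapMatrix A)ᵀ *ᵥ n = 0 → n ⬝ᵥ v = 0) →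
      Complex.ofRealHom.mapMatrix A *ᵥ v = μ • v →
      ∃ ν : ℂ, ‖ν‖ < 1 ∧ Complex.ofRealHom.mapMatrix L *ᵥ v = ν • v) :
    ∃ k, 0 < k ∧ ∃ q, 0 < q ∧ q < 1 ∧ ∀ v : ι → ℝ, (∀ n, Aᵀ *ᵥ n = 0 → n ⬝ᵥ v = 0) →
      ‖(L ^ k) *ᵥ v‖ ≤ q * ‖v‖ := by
  set AC := Complex.ofRealHom.mapMatrix A with hAC
  set LC := Complex.ofRealHom.mapMatrix L with hLC
  have hcomm : AC * LC = LC * AC := by rw [hAC, hLC, ← map_mul, ← map_mul, hAL.eq]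
  let W : Submodule ℂ (ι → ℂ) :=
    { carrier := {v | ∀ n : ι → ℂ, ACᵀ *ᵥ n = 0 → n ⬝ᵥ v = 0}
      add_mem' := fun {a b} ha hb n hn => by rw [dotProduct_add, ha n hn, hb n hn, add_zero]
      zero_mem' := fun n _ => dotProduct_zero n
      smul_mem' := fun c v hv n hn => by rw [dotProduct_smul, hv n hn, smul_zero] }
  have hinv : ∀ B : Matrix ι ι ℂ, AC * B = B * AC → ∀ v ∈ W, B.mulVecLin v ∈ W := by
    intro B hB v hv n hn
    rw [mulVecLin_apply, dotProduct_mulVec, ← mulVec_transpose]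
    refine hv _ ?_
    rw [mulVec_mulVec, ← transpose_mul, ← hB, transpose_mul, ← mulVec_mulVec, hn, mulVec_zero]
  let S : W →ₗ[ℂ] W := AC.mulVecLin.restrict (hinv AC rfl)
  let T : W →ₗ[ℂ] W := LC.mulVecLin.restrict (hinv LC hcomm)
  have hST : Commute S T := by
    ext1 v
    refine Subtype.ext ?_
    change AC *ᵥ (LC *ᵥ (v : ι → ℂ)) = LC *ᵥ (AC *ᵥ (v : ι → ℂ))
    rw [mulVec_mulVec, mulVec_mulVec, hcomm]
  obtain ⟨k, hk, hT⟩ := exists_pow_norm_lt_one_of_commute S T hST fun μ v hv hSv => by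
    obtain ⟨ν, hν, e⟩ := h μ v (fun e => hv (Subtype.ext e)) v.2 (congrArg Subtype.val hSv)
    exact ⟨ν, hν, Subtype.ext e⟩
  have hpow : ∀ (j : ℕ) (w : W), ((T.toContinuousLinearMap ^ j) w : ι → ℂ) = (LC ^ j) *ᵥ w := by
    intro j
    induction j with
    | zero => intro w; simp
    | succ j ih =>
      intro w
      rw [pow_succ, mul_apply_eq_comp, ih, pow_succ, ← mulVec_mulVec]
      rfl
  have hnorm : ∀ u : ι → ℝ, ‖fun i => (u i : ℂ)‖ = ‖u‖ := fun u => by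
    simp [Pi.norm_def]
  -- The maximum with 1/2 keeps q positive, since a root of q is inverted later on.
  refine ⟨k, hk, max ‖T.toContinuousLinearMap ^ k‖ (1 / 2), by positivity,
    max_lt hT (by norm_num), fun v hv => ?_⟩
  -- As A is real, the real and imaginary parts of a complex invariant are real invariants.
  have hvW : (fun i => (v i : ℂ)) ∈ W := by
    intro n hn
    have hre : Aᵀ *ᵥ (fun i => (n i).re) = 0 := by
      ext i
      simpa [mulVec, dotProduct, hAC] using congrArg Complex.re (congrFun hn i)
    have him : Aᵀ *ᵥ (fun i => (n i).im) = 0 := by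
      ext i
      simpa [mulVec, dotProduct, hAC] using congrArg Complex.im (congrFun hn i)
    apply Complex.ext
    · simpa [dotProduct] using hv _ hre
    · simpa [dotProduct] using hv _ him
  have h1 := (T.toContinuousLinearMap ^ k).le_opNorm ⟨_, hvW⟩
  have h2 : ((T.toContinuousLinearMap ^ k) ⟨_, hvW⟩ : ι → ℂ) =
      fun i => (((L ^ k) *ᵥ v) i : ℂ) := by
    rw [hpow, hLC, ← map_pow]
    ext i
    exact (RingHom.map_mulVec Complex.ofRealHom (L ^ k) v i).symm
  rw [Submodule.coe_norm, h2, Submodule.coe_norm, hnorm, hnorm] at h1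
  refine h1.trans ?_
  gcongr
  exact le_max_left _ _

end Contraction

/-! ### Linearized stability of a fixed point -/

/-- Linearized stability of a fixed point, relative to a set of directions on which some power of
the derivative is a contraction. -/
theorem exists_forall_tendsto_iterate {E : Type*} [NormedAddCommGroup E] [NormedSpace ℝ E]
    {g : E → E} {L : E →L[ℝ] E} {x₀ : E} (hfix : g x₀ = x₀) (hg : HasFDerivAt g L x₀)
    {V U : Set E} (hU : U ∈ 𝓝 x₀) (hV : ∀ y ∈ U, y - x₀ ∈ V → g y - x₀ ∈ V)
    {k : ℕ} (hk : 0 < k) {θ : ℝ} (hθ0 : 0 < θ) (hθ1 : θ < 1)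
    (hL : ∀ v ∈ V, ‖(L ^ k) v‖ ≤ θ ^ k * ‖v‖) :
    ∃ δ > 0, ∀ z, z - x₀ ∈ V → ‖z - x₀‖ < δ →
      (∀ n, g^[n] z ∈ U ∧ g^[n] z - x₀ ∈ V) ∧ Tendsto (fun n => g^[n] z) atTop (𝓝 x₀) := by
  -- the adapted norm, in which `L` itself contracts by the factor `θ`
  set M : E → ℝ := fun v => ∑ j ∈ Finset.range k, (θ⁻¹) ^ j * ‖(L ^ j) v‖ with hM
  have hM0 : ∀ v, ‖v‖ ≤ M v := fun v => by
    have := Finset.single_le_sum (f := fun j => (θ⁻¹) ^ j * ‖(L ^ j) v‖)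
      (fun j _ => by positivity) (Finset.mem_range.2 hk)
    simpa only [pow_zero, one_mul, one_apply_eq_self, hM] using this
  have hMadd : ∀ v w, M (v + w) ≤ M v + M w := fun v w => by
    rw [hM, ← Finset.sum_add_distrib]
    refine Finset.sum_le_sum fun j _ => ?_
    rw [← mul_add, map_add]
    gcongr
    exact norm_add_le _ _
  obtain ⟨C, hC1, hC⟩ : ∃ C, 1 ≤ C ∧ ∀ v, M v ≤ C * ‖v‖ := by
    refine ⟨1 + ∑ j ∈ Finset.range k, (θ⁻¹) ^ j * ‖L ^ j‖, ?_, fun v => ?_⟩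
    · have : 0 ≤ ∑ j ∈ Finset.range k, (θ⁻¹) ^ j * ‖L ^ j‖ :=
        Finset.sum_nonneg fun j _ => by positivity
      linarith
    · rw [add_mul, one_mul, Finset.sum_mul]
      refine le_add_of_nonneg_of_le (norm_nonneg v) (Finset.sum_le_sum fun j _ => ?_)
      rw [mul_assoc]
      gcongr
      exact (L ^ j).le_opNorm v
  -- Passing from v to Lv shifts the sum by one index: up to the factor θ, the term ‖v‖ is lost and
  -- θ^(-k)‖L^k v‖ ≤ ‖v‖ is gained. Only the bound at v itself is needed, so V need not be invariant
  -- under L.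
  have hML : ∀ v ∈ V, M (L v) ≤ θ * M v := fun v hv => by
    have e1 : M (L v) = θ * ∑ j ∈ Finset.range k, (θ⁻¹) ^ (j + 1) * ‖(L ^ (j + 1)) v‖ := by
      rw [hM, Finset.mul_sum]
      refine Finset.sum_congr rfl fun j _ => ?_
      rw [pow_succ L, mul_apply_eq_comp, pow_succ (θ⁻¹)]
      field_simp
    rw [e1]
    gcongr
    have e2 := Finset.sum_range_succ (fun j => (θ⁻¹) ^ j * ‖(L ^ j) v‖) k
    rw [Finset.sum_range_succ'] at e2
    have e3 : (θ⁻¹) ^ k * ‖(L ^ k) v‖ ≤ ‖v‖ := by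
      rw [inv_pow, inv_mul_le_iff₀ (by positivity)]
      exact hL v hv
    simp only [pow_zero, one_mul, one_apply_eq_self] at e2
    simp only [hM]
    linarith
  -- Half of the gap 1 - θ is left for the nonlinear remainder, whose adapted norm is at most C
  -- times its norm.
  obtain ⟨ε, hε0, hε⟩ : ∃ ε > 0, θ + C * ε < 1 :=
    ⟨(1 - θ) / (2 * C), by have : 0 < 1 - θ := by linarith
                           positivity, by
      have : C * ((1 - θ) / (2 * C)) = (1 - θ) / 2 := by field_simp
      linarith⟩
  obtain ⟨r, hr0, hr⟩ : ∃ r > 0, ∀ y, ‖y - x₀‖ < r → y ∈ U ∧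
      ‖g y - x₀ - L (y - x₀)‖ ≤ ε * ‖y - x₀‖ := by
    have h1 : ∀ᶠ y in 𝓝 x₀, ‖g y - x₀ - L (y - x₀)‖ ≤ ε * ‖y - x₀‖ := by
      have := (hasFDerivAt_iff_isLittleO.1 hg).def hε0
      simpa [hfix] using this
    obtain ⟨r, hr0, hr⟩ := Metric.eventually_nhds_iff.1 ((eventually_mem_set.2 hU).and h1)
    exact ⟨r, hr0, fun y hy => hr (by rwa [dist_eq_norm])⟩
  have hstep : ∀ y, y - x₀ ∈ V → ‖y - x₀‖ < r → M (g y - x₀) ≤ (θ + C * ε) * M (y - x₀) := by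
    intro y hyV hy
    have h1 := hMadd (L (y - x₀)) (g y - x₀ - L (y - x₀))
    rw [add_sub_cancel] at h1
    have h2 := hML _ hyV
    have h3 := hC (g y - x₀ - L (y - x₀))
    have h4 : C * ‖g y - x₀ - L (y - x₀)‖ ≤ C * (ε * M (y - x₀)) :=
      mul_le_mul_of_nonneg_left ((hr y hy).2.trans
        (mul_le_mul_of_nonneg_left (hM0 _) hε0.le)) (by linarith)
    linarith
  -- ‖z - x₀‖ < r/C gives M(z - x₀) < r; since M dominates the norm and decreases, all iterates stay
  -- in the ball of radius r.
  refine ⟨r / C, by positivity, fun z hzV hz => ?_⟩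
  have hMz : M (z - x₀) < r := by
    refine (hC _).trans_lt ?_
    rwa [lt_div_iff₀ (by linarith), mul_comm] at hz
  have hq0 : 0 ≤ θ + C * ε := by positivity
  have hind : ∀ n, g^[n] z - x₀ ∈ V ∧ M (g^[n] z - x₀) ≤ (θ + C * ε) ^ n * M (z - x₀) := by
    intro n
    induction n with
    | zero => simpa using hzV
    | succ n ih =>
      rw [Function.iterate_succ_apply']
      have hlt : ‖g^[n] z - x₀‖ < r := by
        refine ((hM0 _).trans ih.2).trans_lt (lt_of_le_of_lt ?_ hMz)
        exact mul_le_of_le_one_left ((norm_nonneg _).trans (hM0 _)) (pow_le_one₀ hq0 hε.le)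
      refine ⟨hV _ (hr _ hlt).1 ih.1, (hstep _ ih.1 hlt).trans ?_⟩
      rw [pow_succ', mul_assoc]
      gcongr
      exact ih.2
  refine ⟨fun n => ⟨(hr _ ?_).1, (hind n).1⟩, ?_⟩
  · refine ((hM0 _).trans (hind n).2).trans_lt (lt_of_le_of_lt ?_ hMz)
    exact mul_le_of_le_one_left ((norm_nonneg _).trans (hM0 _)) (pow_le_one₀ hq0 hε.le)
  · rw [tendsto_iff_norm_sub_tendsto_zero]
    refine squeeze_zero (fun _ => norm_nonneg _) (fun n => (hM0 _).trans (hind n).2) ?_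
    simpa using (tendsto_pow_atTop_nhds_zero_of_lt_one hq0 hε).mul_const (M (z - x₀))

/-! ### Linearly implicit stages and their derivatives -/

section Solve

variable {ι : Type*} [Fintype ι] [DecidableEq ι] {E : Type*} [NormedAddCommGroup E]
  [NormedSpace ℝ E]

theorem differentiableAt_det {M : E → Matrix ι ι ℝ} {x : E}
    (h : ∀ i j, DifferentiableAt ℝ (fun y => M y i j) x) :
    DifferentiableAt ℝ (fun y => (M y).det) x := by
  simp_rw [det_apply]
  refine DifferentiableAt.fun_sum fun σ _ => DifferentiableAt.const_smul ?_ _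
  exact (HasFDerivAt.finsetProd fun i _ => (h (σ i) i).hasFDerivAt).differentiableAt

/-- The solution `x` of `x = b + B (D x)`, where `D` acts as a diagonal matrix. -/
noncomputable def solve (B : Matrix ι ι ℝ) (D b : ι → ℝ) : ι → ℝ :=
  (1 - B * diagonal D)⁻¹ *ᵥ b

theorem eq_solve_iff {B : Matrix ι ι ℝ} {D b x : ι → ℝ} (h : (1 - B * diagonal D).det ≠ 0) :
    x = solve B D b ↔ ∀ i, x i = b i + (B *ᵥ fun j => D j * x j) i := by
  have hu : IsUnit (1 - B * diagonal D).det := isUnit_iff_ne_zero.2 h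
  have h1 : x = solve B D b ↔ (1 - B * diagonal D) *ᵥ x = b := by
    rw [solve]
    constructor
    · rintro rfl
      rw [mulVec_mulVec, mul_nonsing_inv _ hu, one_mulVec]
    · rintro rfl
      rw [mulVec_mulVec, nonsing_inv_mul _ hu, one_mulVec]
  have h2 : (1 - B * diagonal D) *ᵥ x = x - B *ᵥ fun j => D j * x j := by
    rw [sub_mulVec, one_mulVec, ← mulVec_mulVec]
    congr 2
    ext j
    exact mulVec_diagonal _ _ _
  rw [h1, h2, sub_eq_iff_eq_add, funext_iff]
  rfl

theorem differentiableAt_det_one_sub {B : Matrix ι ι ℝ} {D : E → ι → ℝ} {x : E}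
    (hD : DifferentiableAt ℝ D x) :
    DifferentiableAt ℝ (fun y => (1 - B * diagonal (D y)).det) x := by
  have hD' := differentiableAt_pi.1 hD
  refine differentiableAt_det fun i j => ?_
  simp only [Matrix.sub_apply, mul_diagonal]
  exact (differentiableAt_const _).sub ((hD' j).const_mul _)

/-- By Cramer's rule the solution is a quotient of polynomials in the data. -/
theorem differentiableAt_solve {B : Matrix ι ι ℝ} {D b : E → ι → ℝ} {x : E}
    (hD : DifferentiableAt ℝ D x) (hb : DifferentiableAt ℝ b x)
    (h : (1 - B * diagonal (D x)).det ≠ 0) :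
    DifferentiableAt ℝ (fun y => solve B (D y) (b y)) x := by
  have hD' := differentiableAt_pi.1 hD
  have hb' := differentiableAt_pi.1 hb
  refine differentiableAt_pi.2 fun i => ?_
  simp only [solve, inv_def, mulVec, dotProduct, Matrix.smul_apply, Ring.inverse_eq_inv', smul_eq_mul,
    adjugate_apply]
  refine DifferentiableAt.fun_sum fun j _ => (DifferentiableAt.mul ?_ ?_).mul (hb' j)
  · exact (differentiableAt_det_one_sub hD).inv h
  · refine differentiableAt_det fun k l => ?_
    simp only [updateRow_apply]
    split_ifs
    · exact differentiableAt_const _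
    · simp only [Matrix.sub_apply, mul_diagonal]
      exact (differentiableAt_const _).sub ((hD' l).const_mul _)

theorem one_sub_mul_diagonal_const (B : Matrix ι ι ℝ) (c : ℝ) :
    1 - B * diagonal (fun _ => c) = 1 - c • B := by
  rw [← smul_one_eq_diagonal, Matrix.mul_smul, mul_one]

theorem solve_const {B : Matrix ι ι ℝ} {c κ : ℝ} {y : ι → ℝ} (hBy : B *ᵥ y = 0)
    (h : (1 - c • B).det ≠ 0) : solve B (fun _ => c) (fun i => κ * y i) = fun i => κ * y i := by
  rw [← one_sub_mul_diagonal_const] at h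
  refine ((eq_solve_iff h).2 fun i => ?_).symm
  have : (B *ᵥ fun j => c * (κ * y j)) = 0 := by
    have e : (fun j => c * (κ * y j)) = (c * κ) • y := by ext; simp [mul_assoc]
    rw [e, mulVec_smul, hBy, smul_zero]
  rw [this, Pi.zero_apply, add_zero]

/-- The derivative of the solution of a Patankar-type stage along a curve through an
equilibrium. -/
theorem hasDerivAt_solve_div {B : Matrix ι ι ℝ} {c κ : ℝ} {y : ι → ℝ} (hy : ∀ i, y i ≠ 0)
    (hBy : B *ᵥ y = 0) (hdet : (1 - c • B).det ≠ 0) {q r b : ℝ → ι → ℝ} {q' r' b' : ι → ℝ}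
    (hq : ∀ i, HasDerivAt (fun t => q t i) (q' i) 0)
    (hr : ∀ i, HasDerivAt (fun t => r t i) (r' i) 0)
    (hb : ∀ i, HasDerivAt (fun t => b t i) (b' i) 0)
    (hq0 : ∀ i, q 0 i = c * y i) (hr0 : ∀ i, r 0 i = y i) (hb0 : ∀ i, b 0 i = κ * y i) (i : ι) :
    HasDerivAt (fun t => solve B (fun j => q t j / r t j) (b t) i)
      (((1 - c • B)⁻¹ *ᵥ (b' + B *ᵥ (κ • (q' - c • r')))) i) 0 := by
  have hrne : ∀ j, r 0 j ≠ 0 := fun j => by rw [hr0]; exact hy j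
  have hD0 : (fun j => q 0 j / r 0 j) = fun _ => c := by
    ext j
    rw [hq0, hr0, mul_div_cancel_right₀ _ (hy j)]
  have hb0' : b 0 = fun i => κ * y i := funext hb0
  have hdet0 : (1 - B * diagonal (fun j => q 0 j / r 0 j)).det ≠ 0 := by
    rwa [hD0, one_sub_mul_diagonal_const]
  have hDd : ∀ j, HasDerivAt (fun t => q t j / r t j) ((q' j - c * r' j) / y j) 0 := fun j => by
    refine ((hq j).fun_div (hr j) (hrne j)).congr_deriv ?_
    rw [hq0, hr0]
    have := hy j
    field_simp
  have hDdiff : DifferentiableAt ℝ (fun t => fun j => q t j / r t j) 0 :=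
    differentiableAt_pi.2 fun j => (hDd j).differentiableAt
  have hbdiff : DifferentiableAt ℝ b 0 := differentiableAt_pi.2 fun j => (hb j).differentiableAt
  have hdiff := differentiableAt_solve hDdiff hbdiff hdet0
  obtain ⟨x, hx⟩ : ∃ x : ℝ → ι → ℝ, x = fun t => solve B (fun j => q t j / r t j) (b t) :=
    ⟨_, rfl⟩
  rw [← hx] at hdiff
  have hx' := hasDerivAt_pi.1 hdiff.hasDerivAt
  have hx0 : x 0 = fun i => κ * y i := by
    rw [hx]
    simp only [hD0, hb0']
    exact solve_const hBy hdet
  -- Once x is known to be differentiable, its derivative is found by differentiating this implicit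
  -- equation, which persists near 0 because the determinant stays nonzero.
  have heq : ∀ᶠ t in 𝓝 0, ∀ i, x t i = b t i + (B *ᵥ fun j => q t j / r t j * x t j) i := by
    filter_upwards [(differentiableAt_det_one_sub (B := B) hDdiff).continuousAt.eventually_ne hdet0]
      with t ht
    exact (eq_solve_iff ht).1 (by rw [hx])
  have hrhs : ∀ i, HasDerivAt (fun t => b t i + (B *ᵥ fun j => q t j / r t j * x t j) i)
      (b' i + (B *ᵥ fun j => κ * (q' j - c * r' j) + c * deriv x 0 j) i) 0 := fun i => by
    refine (hb i).add ?_
    simp only [mulVec, dotProduct]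
    refine HasDerivAt.fun_sum fun j _ => HasDerivAt.const_mul _ ?_
    refine ((hDd j).fun_mul (hx' j)).congr_deriv ?_
    rw [hx0, congrFun hD0 j]
    have := hy j
    field_simp
  -- At the equilibrium the factor y in x = κy cancels the division by y in the derivative of q/r.
  have hlin : (1 - c • B) *ᵥ deriv x 0 = b' + B *ᵥ (κ • (q' - c • r')) := by
    have h1 : deriv x 0 = b' + B *ᵥ (κ • (q' - c • r') + c • deriv x 0) := by
      ext i
      refine (hx' i).unique ((hrhs i).congr_of_eventuallyEq ?_)
      filter_upwards [heq] with t ht using ht i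
    rw [sub_mulVec, one_mulVec, smul_mulVec, sub_eq_iff_eq_add]
    rw [mulVec_add, mulVec_smul B c] at h1
    rw [add_assoc]
    exact h1
  have hfin : deriv x 0 = (1 - c • B)⁻¹ *ᵥ (b' + B *ᵥ (κ • (q' - c • r'))) := by
    rw [← hlin, mulVec_mulVec, nonsing_inv_mul _ (isUnit_iff_ne_zero.2 hdet), one_mulVec]
  have := hx' i
  rwa [hfin, hx] at this

end Solve

/-! ### The scheme as an explicit map -/

section Scheme

variable {ι : Type*} [DecidableEq ι]

theorem smul_linearProduction_add (A : Matrix ι ι ℝ) (c d : ℝ) (x y : ι → ℝ) :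
    c • linearProduction A x + d • linearProduction A y =
      linearProduction A fun j => c * x j + d * y j := by
  ext i j
  simp only [linearProduction, Matrix.add_apply, Matrix.smul_apply, of_apply, smul_eq_mul]
  split_ifs <;> ring

theorem smul_linearProduction_add_add (A : Matrix ι ι ℝ) (c d e : ℝ) (x y z : ι → ℝ) :
    c • linearProduction A x + d • linearProduction A y + e • linearProduction A z =
      linearProduction A fun j => c * x j + d * y j + e * z j := by
  ext i j
  simp only [linearProduction, Matrix.add_apply, Matrix.smul_apply, of_apply, smul_eq_mul]
  split_ifs <;> ring

variable [Fintype ι]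

/-- The coefficient is constant because the production term yⱼ cancels the Patankar weight 1/yⱼ. -/
noncomputable def stage1 (B : Matrix ι ι ℝ) (y : ι → ℝ) : ι → ℝ :=
  solve B (fun _ => β10) y

noncomputable def weight2 (B : Matrix ι ι ℝ) (y : ι → ℝ) (i : ι) : ℝ :=
  n1 * stage1 B y i + n2 * y i * (stage1 B y i / y i) ^ 2

noncomputable def coeff2 (B : Matrix ι ι ℝ) (y : ι → ℝ) (i : ι) : ℝ :=
  (β20 * y i + β21 * stage1 B y i) / weight2 B y i

noncomputable def stage2 (B : Matrix ι ι ℝ) (y : ι → ℝ) : ι → ℝ :=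
  solve B (coeff2 B y) (fun i => α20 * y i + α21 * stage1 B y i)

noncomputable def coeffA (B : Matrix ι ι ℝ) (h s : ℝ) (y : ι → ℝ) (i : ι) : ℝ :=
  (η3 h * y i + η4 * stage1 B y i) / (y i ^ (1 - s) * stage1 B y i ^ s)

noncomputable def stageA (B : Matrix ι ι ℝ) (h s : ℝ) (y : ι → ℝ) : ι → ℝ :=
  solve B (coeffA B h s y) (fun i => η1 h * y i + h * stage1 B y i)

noncomputable def weight3 (B : Matrix ι ι ℝ) (h s : ℝ) (y : ι → ℝ) (i : ι) : ℝ :=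
  stageA B h s y i + ζ * y i * (stage2 B y i / weight2 B y i)

noncomputable def coeff3 (B : Matrix ι ι ℝ) (h s : ℝ) (y : ι → ℝ) (i : ι) : ℝ :=
  (β30 * y i + β31 * stage1 B y i + β32 * stage2 B y i) / weight3 B h s y i

/-- One step of the scheme as a map, with the stages solved for. -/
noncomputable def stepMap (B : Matrix ι ι ℝ) (h s : ℝ) (y : ι → ℝ) : ι → ℝ :=
  solve B (coeff3 B h s y) (fun i => α30 * y i + α31 * stage1 B y i + α32 * stage2 B y i)

/-- The vanishing column sums turn the destruction term, a sum over the off-diagonal entries of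
column i, into the missing diagonal entry of A. -/
theorem weightedRate_linearProduction {A : Matrix ι ι ℝ}
    (hcol : ∀ j, ∑ i, A i j = 0) (q w : ι → ℝ) (i : ι) :
    weightedRate (linearProduction A q) w i = (A *ᵥ fun j => q j * w j) i := by
  have h1 : ∀ P : ι → ℝ, ∑ j, (if i = j then 0 else P j) = (∑ j, P j) - P i := fun P => by
    rw [← Finset.sum_erase_add _ _ (Finset.mem_univ i),
      ← Finset.sum_erase_add Finset.univ P (Finset.mem_univ i)]
    simp only [if_true, add_zero, add_sub_cancel_right]
    exact Finset.sum_congr rfl fun j hj => if_neg (Finset.ne_of_mem_erase hj).symm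
  have e1 : ∑ j, linearProduction A q i j * w j = ∑ j, A i j * (q j * w j) - A i i * (q i * w i) := by
    rw [← h1 fun j => A i j * (q j * w j)]
    refine Finset.sum_congr rfl fun j _ => ?_
    simp only [linearProduction, of_apply]
    split_ifs <;> ring
  have e2 : ∑ j, linearProduction A q j i * w i = (∑ j, A j i) * (q i * w i) - A i i * (q i * w i) := by
    rw [Finset.sum_mul, ← h1 fun j => A j i * (q i * w i)]
    refine Finset.sum_congr rfl fun j _ => ?_
    simp only [linearProduction, of_apply, eq_comm (a := j)]
    split_ifs <;> ring
  rw [weightedRate, e1, e2, hcol]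
  simp [mulVec, dotProduct]

theorem forall_eq_add_weightedRate_iff {A : Matrix ι ι ℝ} (hcol : ∀ j, ∑ i, A i j = 0) {Δt : ℝ}
    {q w b x : ι → ℝ} (hdet : (1 - (Δt • A) * diagonal fun j => q j / w j).det ≠ 0) :
    (∀ i, x i = b i + Δt * weightedRate (linearProduction A q) (fun j => x j / w j) i) ↔
      x = solve (Δt • A) (fun j => q j / w j) b := by
  rw [eq_solve_iff hdet]
  refine forall_congr' fun i => ?_
  rw [weightedRate_linearProduction hcol, smul_mulVec, Pi.smul_apply, smul_eq_mul,
    show (fun j => q j * (x j / w j)) = fun j => q j / w j * x j from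
      funext fun j => by rw [mul_div_left_comm, mul_comm]]

/-- The stages form a triangular sequence: each is linear in its own unknown, with data from the
earlier ones, so nonzero determinants fix them one after another. -/
theorem isStep_iff_eq_stepMap {A : Matrix ι ι ℝ} (hcol : ∀ j, ∑ i, A i j = 0) {h s Δt : ℝ}
    {y y' : ι → ℝ} (hy : ∀ i, y i ≠ 0)
    (hd1 : (1 - (Δt • A) * diagonal fun _ => β10).det ≠ 0)
    (hd2 : (1 - (Δt • A) * diagonal (coeff2 (Δt • A) y)).det ≠ 0)
    (hda : (1 - (Δt • A) * diagonal (coeffA (Δt • A) h s y)).det ≠ 0)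
    (hd3 : (1 - (Δt • A) * diagonal (coeff3 (Δt • A) h s y)).det ≠ 0) :
    IsStep (linearProduction A) h s Δt y y' ↔ y' = stepMap (Δt • A) h s y := by
  have hstage1 : ∀ x : ι → ℝ, (∀ i, x i = y i + β10 * Δt *
      weightedRate (linearProduction A y) (fun j => x j / y j) i) ↔ x = stage1 (Δt • A) y := by
    intro x
    rw [stage1, eq_solve_iff hd1]
    refine forall_congr' fun i => ?_
    rw [weightedRate_linearProduction hcol, smul_mulVec, Pi.smul_apply, smul_eq_mul,
      show (fun j => y j * (x j / y j)) = x from funext fun j => mul_div_cancel₀ _ (hy j),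
      show (fun j => β10 * x j) = β10 • x from rfl, mulVec_smul, Pi.smul_apply, smul_eq_mul,
      mul_left_comm Δt, mul_assoc]
  constructor
  · rintro ⟨y1, ρ, y2, a, σ, h1, hρ, h2, ha, hσ, h3⟩
    obtain rfl := (hstage1 y1).1 h1
    obtain rfl : ρ = weight2 (Δt • A) y := funext hρ
    simp only [smul_linearProduction_add_add] at h3
    simp only [smul_linearProduction_add] at h2 ha
    obtain rfl : y2 = stage2 (Δt • A) y := (forall_eq_add_weightedRate_iff hcol hd2).1 h2
    obtain rfl : a = stageA (Δt • A) h s y := (forall_eq_add_weightedRate_iff hcol hda).1 ha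
    obtain rfl : σ = weight3 (Δt • A) h s y := funext hσ
    exact (forall_eq_add_weightedRate_iff hcol hd3).1 h3
  · rintro rfl
    refine ⟨stage1 (Δt • A) y, weight2 (Δt • A) y, stage2 (Δt • A) y, stageA (Δt • A) h s y,
      weight3 (Δt • A) h s y, (hstage1 _).2 rfl, fun _ => rfl, ?_, ?_, fun _ => rfl, ?_⟩
    · simp only [smul_linearProduction_add]
      exact (forall_eq_add_weightedRate_iff hcol hd2).2 rfl
    · simp only [smul_linearProduction_add]
      exact (forall_eq_add_weightedRate_iff hcol hda).2 rfl
    · simp only [smul_linearProduction_add_add]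
      exact (forall_eq_add_weightedRate_iff hcol hd3).2 rfl

/-- A step preserves the linear invariants. -/
theorem dotProduct_eq_of_isStep {A : Matrix ι ι ℝ} (hcol : ∀ j, ∑ i, A i j = 0) {h s Δt : ℝ}
    {y y' : ι → ℝ} (hstep : IsStep (linearProduction A) h s Δt y y') {n : ι → ℝ}
    (hn : Aᵀ *ᵥ n = 0) : n ⬝ᵥ y' = n ⬝ᵥ y := by
  have hrate : ∀ q w : ι → ℝ, n ⬝ᵥ weightedRate (linearProduction A q) w = 0 := fun q w => by
    rw [show weightedRate (linearProduction A q) w = A *ᵥ fun j => q j * w j from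
      funext (weightedRate_linearProduction hcol q w), dotProduct_mulVec, ← mulVec_transpose, hn,
      zero_dotProduct]
  obtain ⟨y1, ρ, y2, a, σ, h1, hρ, h2, ha, hσ, h3⟩ := hstep
  simp only [smul_linearProduction_add_add] at h3
  simp only [smul_linearProduction_add] at h2
  have e1 : n ⬝ᵥ y1 = n ⬝ᵥ y := by
    rw [show y1 = y + (β10 * Δt) • weightedRate (linearProduction A y) (fun j => y1 j / y j) from
      funext h1, dotProduct_add, dotProduct_smul, hrate, smul_zero, add_zero]
  have e2 : n ⬝ᵥ y2 = n ⬝ᵥ y := by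
    rw [show y2 = α20 • y + α21 • y1 + Δt • weightedRate
        (linearProduction A fun j => β20 * y j + β21 * y1 j) (fun j => y2 j / ρ j) from funext h2]
    simp only [dotProduct_add, dotProduct_smul, hrate, e1, smul_eq_mul]
    rw [α20]
    ring
  rw [show y' = α30 • y + α31 • y1 + α32 • y2 + Δt • weightedRate
      (linearProduction A fun j => β30 * y j + β31 * y1 j + β32 * y2 j) (fun j => y' j / σ j) from
      funext h3]
  simp only [dotProduct_add, dotProduct_smul, hrate, e1, e2, smul_eq_mul]
  rw [α30]
  ring

end Scheme

/-! ### Values and differentiability of the stages at the equilibrium -/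

section Equilibrium

variable {ι : Type*} [Fintype ι] [DecidableEq ι]

theorem η3_add_η4_pos {h : ℝ} (hh : h ≤ r1) : 0 < η3 h + η4 := by
  rw [r1] at hh
  rw [η3, η4]
  norm_num at hh ⊢
  linarith

variable {B : Matrix ι ι ℝ} {y : ι → ℝ}

theorem stage1_eq (hBy : B *ᵥ y = 0) (hdet : ∀ c : ℝ, 0 < c → (1 - c • B).det ≠ 0) :
    stage1 B y = y := by
  simpa [stage1] using solve_const (κ := 1) hBy (hdet β10 (by norm_num [β10]))

theorem weight2_eq (hy : ∀ i, 0 < y i) (hBy : B *ᵥ y = 0)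
    (hdet : ∀ c : ℝ, 0 < c → (1 - c • B).det ≠ 0) : weight2 B y = y := by
  ext i
  rw [weight2, stage1_eq hBy hdet, div_self (hy i).ne', n2]
  ring

theorem coeff2_eq (hy : ∀ i, 0 < y i) (hBy : B *ᵥ y = 0)
    (hdet : ∀ c : ℝ, 0 < c → (1 - c • B).det ≠ 0) : coeff2 B y = fun _ => β20 + β21 := by
  ext i
  rw [coeff2, stage1_eq hBy hdet, weight2_eq hy hBy hdet, ← add_mul,
    mul_div_cancel_right₀ _ (hy i).ne']

theorem stage2_eq (hy : ∀ i, 0 < y i) (hBy : B *ᵥ y = 0)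
    (hdet : ∀ c : ℝ, 0 < c → (1 - c • B).det ≠ 0) : stage2 B y = y := by
  have := solve_const (κ := α20 + α21) hBy (hdet (β20 + β21) (by norm_num [β20, β21]))
  rw [stage2, coeff2_eq hy hBy hdet, stage1_eq hBy hdet]
  simp only [← add_mul, this]
  ext i
  rw [α20]
  ring

theorem rpow_mul_rpow_self {a : ℝ} (ha : 0 < a) (s : ℝ) : a ^ (1 - s) * a ^ s = a := by
  rw [← Real.rpow_add ha, sub_add_cancel, Real.rpow_one]

theorem coeffA_eq (hy : ∀ i, 0 < y i) (hBy : B *ᵥ y = 0)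
    (hdet : ∀ c : ℝ, 0 < c → (1 - c • B).det ≠ 0) (h s : ℝ) : coeffA B h s y = fun _ => η3 h + η4 := by
  ext i
  rw [coeffA, stage1_eq hBy hdet, rpow_mul_rpow_self (hy i), ← add_mul,
    mul_div_cancel_right₀ _ (hy i).ne']

/-- This stage reproduces only the fraction η1 + η2 of the equilibrium; ζ = 1 - η1 - η2 supplies the
rest in `weight3`. -/
theorem stageA_eq (hy : ∀ i, 0 < y i) (hBy : B *ᵥ y = 0)
    (hdet : ∀ c : ℝ, 0 < c → (1 - c • B).det ≠ 0) {h : ℝ} (hh : h ≤ r1) (s : ℝ) :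
    stageA B h s y = fun i => (η1 h + h) * y i := by
  rw [stageA, coeffA_eq hy hBy hdet, stage1_eq hBy hdet]
  simp only [← add_mul]
  exact solve_const hBy (hdet _ (η3_add_η4_pos hh))

theorem weight3_eq (hy : ∀ i, 0 < y i) (hBy : B *ᵥ y = 0)
    (hdet : ∀ c : ℝ, 0 < c → (1 - c • B).det ≠ 0) {h : ℝ} (hh : h ≤ r1) (s : ℝ) :
    weight3 B h s y = y := by
  ext i
  rw [weight3, stageA_eq hy hBy hdet hh, stage2_eq hy hBy hdet, weight2_eq hy hBy hdet,
    div_self (hy i).ne', η1, ζ]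
  ring

theorem coeff3_eq (hy : ∀ i, 0 < y i) (hBy : B *ᵥ y = 0)
    (hdet : ∀ c : ℝ, 0 < c → (1 - c • B).det ≠ 0) {h : ℝ} (hh : h ≤ r1) (s : ℝ) :
    coeff3 B h s y = fun _ => β30 + β31 + β32 := by
  ext i
  rw [coeff3, stage1_eq hBy hdet, stage2_eq hy hBy hdet, weight3_eq hy hBy hdet hh, ← add_mul,
    ← add_mul, mul_div_cancel_right₀ _ (hy i).ne']

theorem stepMap_eq (hy : ∀ i, 0 < y i) (hBy : B *ᵥ y = 0)
    (hdet : ∀ c : ℝ, 0 < c → (1 - c • B).det ≠ 0) {h : ℝ} (hh : h ≤ r1) (s : ℝ) :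
    stepMap B h s y = y := by
  have := solve_const (κ := α30 + α31 + α32) hBy
    (hdet (β30 + β31 + β32) (by norm_num [β30, β31, β32]))
  rw [stepMap, coeff3_eq hy hBy hdet hh, stage1_eq hBy hdet, stage2_eq hy hBy hdet]
  simp only [← add_mul, this]
  ext i
  rw [α30]
  ring

theorem det_one_sub_mul_diagonal_ne_zero (hdet : ∀ c : ℝ, 0 < c → (1 - c • B).det ≠ 0) {D : ι → ℝ} {c : ℝ}
    (hc : 0 < c) (hD : D = fun _ => c) : (1 - B * diagonal D).det ≠ 0 := by
  rw [hD, one_sub_mul_diagonal_const]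
  exact hdet c hc

theorem differentiableAt_fun_div {E : Type*} [NormedAddCommGroup E] [NormedSpace ℝ E]
    {f g : E → ℝ} {x : E} (hf : DifferentiableAt ℝ f x) (hg : DifferentiableAt ℝ g x)
    (hx : g x ≠ 0) : DifferentiableAt ℝ (fun y => f y / g y) x := by
  simp only [div_eq_mul_inv]
  exact hf.mul (hg.inv hx)

theorem differentiableAt_stage1 (hdet : ∀ c : ℝ, 0 < c → (1 - c • B).det ≠ 0) :
    DifferentiableAt ℝ (stage1 B) y :=
  differentiableAt_solve (differentiableAt_const _) differentiableAt_id
    (det_one_sub_mul_diagonal_ne_zero hdet (by norm_num [β10]) rfl)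

theorem differentiableAt_weight2 (hy : ∀ i, 0 < y i) (hdet : ∀ c : ℝ, 0 < c → (1 - c • B).det ≠ 0) :
    DifferentiableAt ℝ (weight2 B) y := by
  have h1 := differentiableAt_pi.1 (differentiableAt_stage1 (y := y) hdet)
  refine differentiableAt_pi.2 fun i => ?_
  have h2 : DifferentiableAt ℝ (fun x : ι → ℝ => x i) y := differentiableAt_apply i y
  exact ((h1 i).const_mul _).add ((h2.const_mul _).mul ((differentiableAt_fun_div (h1 i) h2 (hy i).ne').pow 2))

theorem differentiableAt_coeff2 (hy : ∀ i, 0 < y i) (hBy : B *ᵥ y = 0)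
    (hdet : ∀ c : ℝ, 0 < c → (1 - c • B).det ≠ 0) : DifferentiableAt ℝ (coeff2 B) y := by
  have h1 := differentiableAt_pi.1 (differentiableAt_stage1 (y := y) hdet)
  have h3 := differentiableAt_pi.1 (differentiableAt_weight2 hy hdet)
  refine differentiableAt_pi.2 fun i => ?_
  have h2 : DifferentiableAt ℝ (fun x : ι → ℝ => x i) y := differentiableAt_apply i y
  exact differentiableAt_fun_div ((h2.const_mul _).add ((h1 i).const_mul _)) (h3 i)
    (by rw [weight2_eq hy hBy hdet]; exact (hy i).ne')

theorem differentiableAt_stage2 (hy : ∀ i, 0 < y i) (hBy : B *ᵥ y = 0)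
    (hdet : ∀ c : ℝ, 0 < c → (1 - c • B).det ≠ 0) : DifferentiableAt ℝ (stage2 B) y := by
  refine differentiableAt_solve (differentiableAt_coeff2 hy hBy hdet) ?_
    (det_one_sub_mul_diagonal_ne_zero hdet (by norm_num [β20, β21]) (coeff2_eq hy hBy hdet))
  have h1 := differentiableAt_pi.1 (differentiableAt_stage1 (y := y) hdet)
  refine differentiableAt_pi.2 fun i => ?_
  exact ((differentiableAt_apply i y).const_mul _).add ((h1 i).const_mul _)

theorem differentiableAt_coeffA (hy : ∀ i, 0 < y i) (hBy : B *ᵥ y = 0)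
    (hdet : ∀ c : ℝ, 0 < c → (1 - c • B).det ≠ 0) (h s : ℝ) : DifferentiableAt ℝ (coeffA B h s) y := by
  have h1 := differentiableAt_pi.1 (differentiableAt_stage1 (y := y) hdet)
  refine differentiableAt_pi.2 fun i => ?_
  have h2 : DifferentiableAt ℝ (fun x : ι → ℝ => x i) y := differentiableAt_apply i y
  have hy1 : stage1 B y i ≠ 0 := by rw [stage1_eq hBy hdet]; exact (hy i).ne'
  refine differentiableAt_fun_div ((h2.const_mul _).add ((h1 i).const_mul _))
    ((h2.rpow_const (Or.inl (hy i).ne')).mul ((h1 i).rpow_const (Or.inl hy1))) ?_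
  rw [stage1_eq hBy hdet]
  exact (mul_pos (Real.rpow_pos_of_pos (hy i) _) (Real.rpow_pos_of_pos (hy i) _)).ne'

theorem differentiableAt_stageA (hy : ∀ i, 0 < y i) (hBy : B *ᵥ y = 0)
    (hdet : ∀ c : ℝ, 0 < c → (1 - c • B).det ≠ 0) {h : ℝ} (hh : h ≤ r1) (s : ℝ) :
    DifferentiableAt ℝ (stageA B h s) y := by
  refine differentiableAt_solve (differentiableAt_coeffA hy hBy hdet h s) ?_
    (det_one_sub_mul_diagonal_ne_zero hdet (η3_add_η4_pos hh) (coeffA_eq hy hBy hdet h s))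
  have h1 := differentiableAt_pi.1 (differentiableAt_stage1 (y := y) hdet)
  refine differentiableAt_pi.2 fun i => ?_
  exact ((differentiableAt_apply i y).const_mul _).add ((h1 i).const_mul _)

theorem differentiableAt_coeff3 (hy : ∀ i, 0 < y i) (hBy : B *ᵥ y = 0)
    (hdet : ∀ c : ℝ, 0 < c → (1 - c • B).det ≠ 0) {h : ℝ} (hh : h ≤ r1) (s : ℝ) :
    DifferentiableAt ℝ (coeff3 B h s) y := by
  have h1 := differentiableAt_pi.1 (differentiableAt_stage1 (y := y) hdet)
  have hw := differentiableAt_pi.1 (differentiableAt_weight2 hy hdet)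
  have h2 := differentiableAt_pi.1 (differentiableAt_stage2 hy hBy hdet)
  have ha := differentiableAt_pi.1 (differentiableAt_stageA hy hBy hdet hh s)
  refine differentiableAt_pi.2 fun i => ?_
  have h0 : DifferentiableAt ℝ (fun x : ι → ℝ => x i) y := differentiableAt_apply i y
  refine differentiableAt_fun_div
    (((h0.const_mul _).add ((h1 i).const_mul _)).add ((h2 i).const_mul _))
    ((ha i).add ((h0.const_mul _).mul (differentiableAt_fun_div (h2 i) (hw i) ?_))) ?_
  · rw [weight2_eq hy hBy hdet]
    exact (hy i).ne'
  · have := congrFun (weight3_eq hy hBy hdet hh s) i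
    rw [weight3] at this
    exact this.trans_ne (hy i).ne'

theorem differentiableAt_stepMap (hy : ∀ i, 0 < y i) (hBy : B *ᵥ y = 0)
    (hdet : ∀ c : ℝ, 0 < c → (1 - c • B).det ≠ 0) {h : ℝ} (hh : h ≤ r1) (s : ℝ) :
    DifferentiableAt ℝ (stepMap B h s) y := by
  refine differentiableAt_solve (differentiableAt_coeff3 hy hBy hdet hh s) ?_
    (det_one_sub_mul_diagonal_ne_zero hdet (by norm_num [β30, β31, β32])
      (coeff3_eq hy hBy hdet hh s))
  have h1 := differentiableAt_pi.1 (differentiableAt_stage1 (y := y) hdet)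
  have h2 := differentiableAt_pi.1 (differentiableAt_stage2 hy hBy hdet)
  refine differentiableAt_pi.2 fun i => ?_
  exact (((differentiableAt_apply i y).const_mul _).add ((h1 i).const_mul _)).add
    ((h2 i).const_mul _)

end Equilibrium

/-! ### The derivative of one step at the equilibrium -/

section Linearization

variable {ι : Type*} [Fintype ι] [DecidableEq ι]

/-! The derivatives of the stages at an equilibrium, as matrices. -/

noncomputable def lin1 (B : Matrix ι ι ℝ) : Matrix ι ι ℝ := (1 - β10 • B)⁻¹

noncomputable def linW2 (B : Matrix ι ι ℝ) : Matrix ι ι ℝ :=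
  n1 • lin1 B + n2 • ((2 : ℝ) • lin1 B - 1)

noncomputable def lin2 (B : Matrix ι ι ℝ) : Matrix ι ι ℝ :=
  (1 - (β20 + β21) • B)⁻¹ * (α20 • 1 + α21 • lin1 B
    + B * (β20 • 1 + β21 • lin1 B - (β20 + β21) • linW2 B))

noncomputable def linA (B : Matrix ι ι ℝ) (h s : ℝ) : Matrix ι ι ℝ :=
  (1 - (η3 h + η4) • B)⁻¹ * (η1 h • 1 + h • lin1 B
    + B * ((η1 h + h) • (η3 h • 1 + η4 • lin1 B - (η3 h + η4) • ((1 - s) • 1 + s • lin1 B))))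

noncomputable def linW3 (B : Matrix ι ι ℝ) (h s : ℝ) : Matrix ι ι ℝ :=
  linA B h s + ζ • (1 + lin2 B - linW2 B)

noncomputable def linStep (B : Matrix ι ι ℝ) (h s : ℝ) : Matrix ι ι ℝ :=
  (1 - (β30 + β31 + β32) • B)⁻¹ * (α30 • 1 + α31 • lin1 B + α32 • lin2 B
    + B * (β30 • 1 + β31 • lin1 B + β32 • lin2 B - (β30 + β31 + β32) • linW3 B h s))

variable {B : Matrix ι ι ℝ} {y : ι → ℝ}

theorem hasDerivAt_line {ι : Type*} (y v : ι → ℝ) (i : ι) : HasDerivAt (fun t : ℝ => (y + t • v) i) (v i) 0 := by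
  simpa using ((hasDerivAt_id (0 : ℝ)).mul_const (v i)).const_add (y i)

theorem hasDerivAt_stage1 (v : ι → ℝ) (i : ι) :
    HasDerivAt (fun t : ℝ => stage1 B (y + t • v) i) ((lin1 B *ᵥ v) i) 0 := by
  have h1 : (fun t : ℝ => stage1 B (y + t • v) i) =
      fun t => (lin1 B *ᵥ y + t • lin1 B *ᵥ v) i := by
    ext t
    rw [stage1, solve, one_sub_mul_diagonal_const, mulVec_add, mulVec_smul, lin1]
  rw [h1]
  exact hasDerivAt_line _ _ i

theorem hasDerivAt_weight2 (hy : ∀ i, 0 < y i) (hBy : B *ᵥ y = 0)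
    (hdet : ∀ c : ℝ, 0 < c → (1 - c • B).det ≠ 0) (v : ι → ℝ) (i : ι) :
    HasDerivAt (fun t : ℝ => weight2 B (y + t • v) i) ((linW2 B *ᵥ v) i) 0 := by
  have h0 := hasDerivAt_line y v i
  have h1 := hasDerivAt_stage1 (B := B) (y := y) v i
  have hy0 : (y + (0 : ℝ) • v) i = y i := by simp
  have hy1 : stage1 B (y + (0 : ℝ) • v) i = y i := by rw [zero_smul, add_zero, stage1_eq hBy hdet]
  have hne := (hy i).ne'
  refine ((h1.const_mul n1).add ((h0.const_mul n2).mul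
    ((h1.fun_div h0 (by rwa [hy0])).fun_pow 2))).congr_deriv ?_
  simp only [hy0, hy1, linW2, add_mulVec, smul_mulVec, sub_mulVec, one_mulVec, Pi.add_apply,
    Pi.smul_apply, Pi.sub_apply, smul_eq_mul]
  field_simp
  push_cast
  ring

theorem hasDerivAt_stage2 (hy : ∀ i, 0 < y i) (hBy : B *ᵥ y = 0)
    (hdet : ∀ c : ℝ, 0 < c → (1 - c • B).det ≠ 0) (v : ι → ℝ) (i : ι) :
    HasDerivAt (fun t : ℝ => stage2 B (y + t • v) i) ((lin2 B *ᵥ v) i) 0 := by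
  have h0 := hasDerivAt_line y v
  have h1 := hasDerivAt_stage1 (B := B) (y := y) v
  have hw := hasDerivAt_weight2 hy hBy hdet v
  have e0 : y + (0 : ℝ) • v = y := by simp
  refine (hasDerivAt_solve_div (κ := α20 + α21) (fun i => (hy i).ne') hBy
    (hdet (β20 + β21) (by norm_num [β20, β21]))
    (fun i => ((h0 i).const_mul β20).add ((h1 i).const_mul β21)) hw
    (fun i => ((h0 i).const_mul α20).add ((h1 i).const_mul α21))
    (fun j => ?_) (fun j => ?_) (fun j => ?_) i).congr_deriv ?_
  · simp [stage1_eq hBy hdet, add_mul]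
  · rw [e0, weight2_eq hy hBy hdet]
  · simp [stage1_eq hBy hdet, add_mul]
  -- What remains is to recognize both summands of the derivative as matrices applied to v.
  · rw [show α20 + α21 = 1 by rw [α20]; ring, one_smul, lin2, ← mulVec_mulVec]
    refine congrFun (congrArg _ (Eq.trans (congrArg₂ (· + ·) ?_ ((congrArg (B *ᵥ ·) ?_).trans
      (mulVec_mulVec _ _ _))) (add_mulVec _ _ _).symm)) i <;> ext j <;>
      simp [add_mulVec, sub_mulVec, smul_mulVec]

theorem hasDerivAt_stageA (hy : ∀ i, 0 < y i) (hBy : B *ᵥ y = 0)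
    (hdet : ∀ c : ℝ, 0 < c → (1 - c • B).det ≠ 0) {h : ℝ} (hh : h ≤ r1) (s : ℝ) (v : ι → ℝ)
    (i : ι) :
    HasDerivAt (fun t : ℝ => stageA B h s (y + t • v) i) ((linA B h s *ᵥ v) i) 0 := by
  have h0 := hasDerivAt_line y v
  have h1 := hasDerivAt_stage1 (B := B) (y := y) v
  have e0 : y + (0 : ℝ) • v = y := by simp
  have hy0 : ∀ i, (y + (0 : ℝ) • v) i ≠ 0 := fun i => by rw [e0]; exact (hy i).ne'
  have hy1 : ∀ i, stage1 B (y + (0 : ℝ) • v) i ≠ 0 := fun i => by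
    rw [e0, stage1_eq hBy hdet]; exact (hy i).ne'
  -- The weighted geometric mean of yᵢ and its first stage linearizes to the weighted arithmetic
  -- mean, since both equal yᵢ at the equilibrium.
  have hw : ∀ i, HasDerivAt
      (fun t : ℝ => (y + t • v) i ^ (1 - s) * stage1 B (y + t • v) i ^ s)
      ((((1 - s) • (1 : Matrix ι ι ℝ) + s • lin1 B) *ᵥ v) i) 0 := fun i => by
    refine (((h0 i).rpow_const (p := 1 - s) (Or.inl (hy0 i))).mul
      ((h1 i).rpow_const (p := s) (Or.inl (hy1 i)))).congr_deriv ?_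
    have e1 : y i ^ (1 - s - 1) * y i ^ s = 1 := by
      rw [← Real.rpow_add (hy i), show 1 - s - 1 + s = 0 by ring, Real.rpow_zero]
    have e2 : y i ^ (1 - s) * y i ^ (s - 1) = 1 := by
      rw [← Real.rpow_add (hy i), show 1 - s + (s - 1) = 0 by ring, Real.rpow_zero]
    simp only [zero_smul, add_zero, Pi.zero_apply, stage1_eq hBy hdet, add_mulVec, smul_mulVec, one_mulVec, Pi.add_apply,
      Pi.smul_apply, smul_eq_mul]
    linear_combination v i * (1 - s) * e1 + (lin1 B *ᵥ v) i * s * e2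
  refine (hasDerivAt_solve_div (κ := η1 h + h) (fun i => (hy i).ne') hBy
    (hdet (η3 h + η4) (η3_add_η4_pos hh))
    (fun i => ((h0 i).const_mul (η3 h)).add ((h1 i).const_mul η4)) hw
    (fun i => ((h0 i).const_mul (η1 h)).add ((h1 i).const_mul h))
    (fun j => ?_) (fun j => ?_) (fun j => ?_) i).congr_deriv ?_
  · simp [stage1_eq hBy hdet, add_mul]
  · rw [e0, stage1_eq hBy hdet, rpow_mul_rpow_self (hy j)]
  · simp [stage1_eq hBy hdet, add_mul]
  · rw [linA, ← mulVec_mulVec]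
    refine congrFun (congrArg _ (Eq.trans (congrArg₂ (· + ·) ?_ ((congrArg (B *ᵥ ·) ?_).trans
      (mulVec_mulVec _ _ _))) (add_mulVec _ _ _).symm)) i <;> ext j <;>
      simp [add_mulVec, sub_mulVec, smul_mulVec]

theorem hasDerivAt_stepMap (hy : ∀ i, 0 < y i) (hBy : B *ᵥ y = 0)
    (hdet : ∀ c : ℝ, 0 < c → (1 - c • B).det ≠ 0) {h : ℝ} (hh : h ≤ r1) (s : ℝ) (v : ι → ℝ)
    (i : ι) :
    HasDerivAt (fun t : ℝ => stepMap B h s (y + t • v) i) ((linStep B h s *ᵥ v) i) 0 := by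
  have h0 := hasDerivAt_line y v
  have h1 := hasDerivAt_stage1 (B := B) (y := y) v
  have hw2 := hasDerivAt_weight2 hy hBy hdet v
  have h2 := hasDerivAt_stage2 hy hBy hdet v
  have ha := hasDerivAt_stageA hy hBy hdet hh s v
  have e0 : y + (0 : ℝ) • v = y := by simp
  have hw3 : ∀ i, HasDerivAt (fun t : ℝ => weight3 B h s (y + t • v) i)
      ((linW3 B h s *ᵥ v) i) 0 := fun i => by
    have hne := (hy i).ne'
    refine ((ha i).add (((h0 i).const_mul ζ).mul ((h2 i).fun_div (hw2 i) ?_))).congr_deriv ?_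
    · rwa [e0, weight2_eq hy hBy hdet]
    · simp only [zero_smul, add_zero, Pi.zero_apply, stage2_eq hy hBy hdet, weight2_eq hy hBy hdet, linW3, add_mulVec,
        sub_mulVec, smul_mulVec, one_mulVec, Pi.add_apply, Pi.smul_apply, Pi.sub_apply, smul_eq_mul]
      field_simp
      ring
  refine (hasDerivAt_solve_div (κ := α30 + α31 + α32) (fun i => (hy i).ne') hBy
    (hdet (β30 + β31 + β32) (by norm_num [β30, β31, β32]))
    (fun i => (((h0 i).const_mul β30).add ((h1 i).const_mul β31)).add ((h2 i).const_mul β32)) hw3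
    (fun i => (((h0 i).const_mul α30).add ((h1 i).const_mul α31)).add ((h2 i).const_mul α32))
    (fun j => ?_) (fun j => ?_) (fun j => ?_) i).congr_deriv ?_
  · simp [stage1_eq hBy hdet, stage2_eq hy hBy hdet, add_mul]
  · rw [e0, weight3_eq hy hBy hdet hh]
  · simp [stage1_eq hBy hdet, stage2_eq hy hBy hdet, add_mul]
  · rw [show α30 + α31 + α32 = 1 by rw [α30]; ring, one_smul, linStep, ← mulVec_mulVec]
    refine congrFun (congrArg _ (Eq.trans (congrArg₂ (· + ·) ?_ ((congrArg (B *ᵥ ·) ?_).trans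
      (mulVec_mulVec _ _ _))) (add_mulVec _ _ _).symm)) i <;> ext j <;>
      simp [add_mulVec, sub_mulVec, smul_mulVec]

/-- Differentiability is already known, so the derivatives along lines identify the Fréchet
derivative. -/
theorem hasFDerivAt_stepMap (hy : ∀ i, 0 < y i) (hBy : B *ᵥ y = 0)
    (hdet : ∀ c : ℝ, 0 < c → (1 - c • B).det ≠ 0) {h : ℝ} (hh : h ≤ r1) (s : ℝ) :
    HasFDerivAt (stepMap B h s) (linStep B h s).mulVecLin.toContinuousLinearMap y := by
  have hdiff := differentiableAt_stepMap hy hBy hdet hh s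
  convert hdiff.hasFDerivAt using 1
  ext1 v
  have h1 : HasDerivAt (fun t : ℝ => stepMap B h s (y + t • v)) (fderiv ℝ (stepMap B h s) y v) 0 :=
    hdiff.hasFDerivAt.hasLineDerivAt v
  exact (hasDerivAt_pi.2 fun i => hasDerivAt_stepMap hy hBy hdet hh s v i).unique h1

end Linearization

/-! ### The linearized scheme on eigenvectors -/

section Spectrum

variable {ι : Type*} [Fintype ι] [DecidableEq ι]

theorem commute_inv_one_sub_smul (B : Matrix ι ι ℝ) (c : ℝ) : Commute B (1 - c • B)⁻¹ := by
  have hc : B * (1 - c • B) = (1 - c • B) * B :=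
    (Commute.one_right B).sub_right ((Commute.refl B).smul_right c)
  by_cases h : IsUnit (1 - c • B).det
  · calc B * (1 - c • B)⁻¹ = (1 - c • B)⁻¹ * ((1 - c • B) * B) * (1 - c • B)⁻¹ := by
          rw [← Matrix.mul_assoc, nonsing_inv_mul _ h, Matrix.one_mul]
      _ = (1 - c • B)⁻¹ * B := by
          rw [← hc, Matrix.mul_assoc, Matrix.mul_assoc, mul_nonsing_inv _ h, Matrix.mul_one]
  · rw [nonsing_inv_apply_not_isUnit _ h]
    exact Commute.zero_right B

theorem commute_linStep (B : Matrix ι ι ℝ) (h s : ℝ) : Commute B (linStep B h s) := by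
  have h0 : ∀ c : ℝ, Commute B (c • 1) := fun c => (Commute.one_right B).smul_right c
  have hB := Commute.refl B
  have h1 : Commute B (lin1 B) := commute_inv_one_sub_smul B _
  have hw : Commute B (linW2 B) :=
    (h1.smul_right _).add_right (((h1.smul_right _).sub_right (Commute.one_right B)).smul_right _)
  have h2 : Commute B (lin2 B) := (commute_inv_one_sub_smul B _).mul_right
    (((h0 _).add_right (h1.smul_right _)).add_right (hB.mul_right
      (((h0 _).add_right (h1.smul_right _)).sub_right (hw.smul_right _))))
  have ha : Commute B (linA B h s) := (commute_inv_one_sub_smul B _).mul_right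
    (((h0 _).add_right (h1.smul_right _)).add_right (hB.mul_right
      ((((h0 _).add_right (h1.smul_right _)).sub_right
        (((h0 _).add_right (h1.smul_right _)).smul_right _)).smul_right _)))
  have hw3 : Commute B (linW3 B h s) :=
    ha.add_right ((((Commute.one_right B).add_right h2).sub_right hw).smul_right _)
  exact (commute_inv_one_sub_smul B _).mul_right
    ((((h0 _).add_right (h1.smul_right _)).add_right (h2.smul_right _)).add_right (hB.mul_right
      ((((h0 _).add_right (h1.smul_right _)).add_right (h2.smul_right _)).sub_right
        (hw3.smul_right _))))

/-- The complexification of the real matrix `X` acts on `w` as the scalar `γ`. -/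
def ActsAs (w : ι → ℂ) (X : Matrix ι ι ℝ) (γ : ℂ) : Prop :=
  Complex.ofRealHom.mapMatrix X *ᵥ w = γ • w

namespace ActsAs

variable {w : ι → ℂ} {X Y : Matrix ι ι ℝ} {γ κ : ℂ}

theorem one : ActsAs w 1 1 := by
  rw [ActsAs, map_one, one_mulVec, one_smul]

theorem add (hX : ActsAs w X γ) (hY : ActsAs w Y κ) : ActsAs w (X + Y) (γ + κ) := by
  rw [ActsAs] at *
  rw [map_add, add_mulVec, hX, hY, add_smul]

theorem sub (hX : ActsAs w X γ) (hY : ActsAs w Y κ) : ActsAs w (X - Y) (γ - κ) := by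
  rw [ActsAs] at *
  rw [map_sub, sub_mulVec, hX, hY, sub_smul]

theorem smul (hX : ActsAs w X γ) (c : ℝ) : ActsAs w (c • X) (c * γ) := by
  rw [ActsAs] at *
  have : Complex.ofRealHom.mapMatrix (c • X) = (c : ℂ) • Complex.ofRealHom.mapMatrix X := by
    ext i j
    simp
  rw [this, smul_mulVec, hX, smul_smul]

theorem mul (hX : ActsAs w X γ) (hY : ActsAs w Y κ) : ActsAs w (X * Y) (γ * κ) := by
  rw [ActsAs] at *
  rw [map_mul, ← mulVec_mulVec, hY, mulVec_smul, hX, smul_smul, mul_comm]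

theorem inv_one_sub_smul {B : Matrix ι ι ℝ} {z : ℂ} (hB : ActsAs w B z) (hz : z.re < 0) {c : ℝ}
    (hc : 0 < c) (hdet : (1 - c • B).det ≠ 0) :
    ActsAs w (1 - c • B)⁻¹ (1 - c * z)⁻¹ ∧ (1 - (c : ℂ) * z) ≠ 0 := by
  -- The real part 1 - c Re z exceeds 1.
  have hne : (1 - (c : ℂ) * z) ≠ 0 := fun e => by
    have := congrArg Complex.re e
    simp at this
    nlinarith
  refine ⟨?_, hne⟩
  have h1 : ActsAs w (1 - c • B) (1 - c * z) := one.sub (hB.smul c)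
  rw [ActsAs] at *
  rw [eq_inv_smul_iff₀ hne, ← mulVec_smul, ← h1, mulVec_mulVec, ← map_mul,
    nonsing_inv_mul _ (isUnit_iff_ne_zero.2 hdet), map_one, one_mulVec]

/-- A stage of the linearized scheme acts on an eigenvector as a scalar. -/
theorem exists_stage {B : Matrix ι ι ℝ} {z : ℂ} (hB : ActsAs w B z) (hz : z.re < 0) {c : ℝ}
    (hc : 0 < c) (hdet : (1 - c • B).det ≠ 0) (hX : ActsAs w X γ) :
    ∃ l, (1 - (c : ℂ) * z) * l = γ ∧ ActsAs w ((1 - c • B)⁻¹ * X) l := by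
  obtain ⟨h1, hne⟩ := inv_one_sub_smul hB hz hc hdet
  exact ⟨_, mul_inv_cancel_left₀ hne γ, h1.mul hX⟩

end ActsAs

/-- On eigenvectors with eigenvalue in the open left half plane, the linearized scheme acts as a
scalar of modulus less than one. -/
theorem exists_actsAs_linStep {B : Matrix ι ι ℝ}
    (hdet : ∀ c : ℝ, 0 < c → (1 - c • B).det ≠ 0) {h s : ℝ} (hh : h ∈ Set.Icc 0 r1)
    (hs : s ∈ Set.Icc (5.6 : ℝ) 5.75) {z : ℂ} (hz : z.re < 0) {w : ι → ℂ} (hB : ActsAs w B z) :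
    ∃ ν : ℂ, ‖ν‖ < 1 ∧ ActsAs w (linStep B h s) ν := by
  have p1 : 0 < β10 := by norm_num [β10]
  have p2 : 0 < β20 + β21 := by norm_num [β20, β21]
  have p3 : 0 < β30 + β31 + β32 := by norm_num [β30, β31, β32]
  have pa := η3_add_η4_pos hh.2
  obtain ⟨l1, e1, a1⟩ := hB.exists_stage hz p1 (hdet _ p1) (ActsAs.one (w := w))
  rw [mul_one] at a1
  change ActsAs w (lin1 B) l1 at a1
  have one := ActsAs.one (w := w)
  have aw2 : ActsAs w (linW2 B) _ := (a1.smul n1).add (((a1.smul 2).sub one).smul n2)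
  obtain ⟨l2, e2, a2⟩ := hB.exists_stage hz p2 (hdet _ p2)
    (((one.smul α20).add (a1.smul α21)).add
      (hB.mul (((one.smul β20).add (a1.smul β21)).sub (aw2.smul (β20 + β21)))))
  change ActsAs w (lin2 B) l2 at a2
  obtain ⟨la, ea, aa⟩ := hB.exists_stage hz pa (hdet _ pa)
    (((one.smul (η1 h)).add (a1.smul h)).add
      (hB.mul ((((one.smul (η3 h)).add (a1.smul η4)).sub
        (((one.smul (1 - s)).add (a1.smul s)).smul (η3 h + η4))).smul (η1 h + h))))
  change ActsAs w (linA B h s) la at aa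
  have aw3 : ActsAs w (linW3 B h s) _ := aa.add (((one.add a2).sub aw2).smul ζ)
  obtain ⟨l, e3, a3⟩ := hB.exists_stage hz p3 (hdet _ p3)
    ((((one.smul α30).add (a1.smul α31)).add (a2.smul α32)).add
      (hB.mul ((((one.smul β30).add (a1.smul β31)).add (a2.smul β32)).sub
        (aw3.smul (β30 + β31 + β32)))))
  -- The scalars by which the stage derivatives act satisfy the staged equations of the stability
  -- function.
  refine ⟨l, norm_stability_lt_one (l2 := l2) (la := la) hh hs hz e1 ?_ ?_ ?_, a3⟩
  · rw [e2]
    push_cast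
    ring
  · rw [ea]
    push_cast
    ring
  · rw [e3]
    push_cast
    ring

end Spectrum

/-! ### Iterates near the equilibrium -/

section Convergence

variable {ι : Type*} [Fintype ι]

/-- If the scheme is single-valued along the iterates of `g`, they are the only iterates of the
scheme. -/
theorem isIterates_iff {p : (ι → ℝ) → Matrix ι ι ℝ} {h s Δt : ℝ} {g : (ι → ℝ) → ι → ℝ} {z : ι → ℝ}
    (hg : ∀ n x', IsStep p h s Δt (g^[n] z) x' ↔ x' = g (g^[n] z)) (Y : ℕ → ι → ℝ) :
    IsIterates p h s Δt z Y ↔ Y = fun n => g^[n] z := by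
  constructor
  · rintro ⟨h0, hstep⟩
    ext1 n
    induction n with
    | zero => exact h0
    | succ n ih =>
      have := hstep n
      rw [ih, hg] at this
      rw [this, Function.iterate_succ_apply']
  · rintro rfl
    exact ⟨rfl, fun n => (hg n _).2 (Function.iterate_succ_apply' g n z)⟩

theorem sameInvariants_iff {A : Matrix ι ι ℝ} {x y : ι → ℝ} :
    SameInvariants A x y ↔ ∀ n, Aᵀ *ᵥ n = 0 → n ⬝ᵥ (x - y) = 0 := by
  simp only [SameInvariants, dotProduct_sub, sub_eq_zero]

variable [DecidableEq ι]

/-- Near a positive equilibrium the scheme is the map `stepMap`. -/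
theorem eventually_isStep_iff {A : Matrix ι ι ℝ} (hcol : ∀ j, ∑ i, A i j = 0) {Δt : ℝ}
    {y : ι → ℝ} (hy : ∀ i, 0 < y i) (hBy : (Δt • A) *ᵥ y = 0)
    (hdet : ∀ c : ℝ, 0 < c → (1 - c • Δt • A).det ≠ 0) {h : ℝ} (hh : h ≤ r1) (s : ℝ) :
    ∀ᶠ x in 𝓝 y, (∀ i, 0 < x i) ∧
      ∀ x', IsStep (linearProduction A) h s Δt x x' ↔ x' = stepMap (Δt • A) h s x := by
  have hne : ∀ {D : (ι → ℝ) → ι → ℝ} {c : ℝ}, DifferentiableAt ℝ D y → 0 < c → D y = (fun _ => c) →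
      ∀ᶠ x in 𝓝 y, (1 - (Δt • A) * diagonal (D x)).det ≠ 0 := fun hD hc hDy =>
    (differentiableAt_det_one_sub hD).continuousAt.eventually_ne
      (det_one_sub_mul_diagonal_ne_zero hdet hc hDy)
  have hpos : ∀ᶠ x in 𝓝 y, ∀ i, 0 < x i := eventually_all.2 fun i =>
    (continuous_apply i).continuousAt.eventually (lt_mem_nhds (hy i))
  filter_upwards [hpos,
    hne (differentiableAt_coeff2 hy hBy hdet) (by norm_num [β20, β21]) (coeff2_eq hy hBy hdet),
    hne (differentiableAt_coeffA hy hBy hdet h s) (η3_add_η4_pos hh) (coeffA_eq hy hBy hdet h s),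
    hne (differentiableAt_coeff3 hy hBy hdet hh s) (by norm_num [β30, β31, β32])
      (coeff3_eq hy hBy hdet hh s)] with x hx h2 ha h3
  exact ⟨hx, fun x' => isStep_iff_eq_stepMap hcol (fun i => (hx i).ne')
    (det_one_sub_mul_diagonal_ne_zero hdet (by norm_num [β10]) rfl) h2 ha h3⟩

/-- Some power of the linearized scheme contracts the vectors without linear invariants. -/
theorem exists_pow_linStep_contraction {B : Matrix ι ι ℝ} (hM : ∀ i j, i ≠ j → 0 ≤ B i j)
    (hcons : Bᵀ *ᵥ (fun _ => (1 : ℝ)) = 0) {y : ι → ℝ} (hy : ∀ i, 0 < y i) (hBy : B *ᵥ y = 0)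
    {h s : ℝ} (hh : h ∈ Set.Icc 0 r1) (hs : s ∈ Set.Icc (5.6 : ℝ) 5.75) :
    ∃ k, 0 < k ∧ ∃ θ : ℝ, 0 < θ ∧ θ < 1 ∧ ∀ v : ι → ℝ, (∀ n, Bᵀ *ᵥ n = 0 → n ⬝ᵥ v = 0) →
      ‖(linStep B h s ^ k) *ᵥ v‖ ≤ θ ^ k * ‖v‖ := by
  have hdet : ∀ c : ℝ, 0 < c → (1 - c • B).det ≠ 0 := fun c hc =>
    det_one_sub_smul_ne_zero hM hcons hy hBy hc
  obtain ⟨k, hk, q, hq0, hq1, hq⟩ := exists_pow_mulVec_contraction (commute_linStep B h s)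
    fun μ v hv hV hBv => exists_actsAs_linStep hdet hh hs
      (re_lt_zero_of_mulVec_eq_smul hM hcons hy hBy hv hBv hV) hBv
  -- θ is the k-th root of q, so that θ^k = q is the contraction factor of the k-th power.
  refine ⟨k, hk, q ^ (k : ℝ)⁻¹, Real.rpow_pos_of_pos hq0 _,
    Real.rpow_lt_one hq0.le hq1 (by positivity), fun v hv => ?_⟩
  rw [Real.rpow_inv_natCast_pow hq0.le hk.ne']
  exact hq v hv

end Convergence

end SSPMPRK3

/-! ### The convergence theorem -/

theorem mainTheorem6 (N : ℕ) (A : Matrix (Fin N) (Fin N) ℝ)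
    (hMetzler : ∀ i j, i ≠ j → 0 ≤ A i j)
    (hcons : Aᵀ *ᵥ (fun _ => (1 : ℝ)) = 0)
    (y0 : Fin N → ℝ) (hy0 : ∀ i, 0 < y0 i)
    (ystar : Fin N → ℝ) (hsteady : SSPMPRK3.IsSteadyState A y0 ystar)
    (hpos : ∀ i, 0 < ystar i) :
    (∀ x, SSPMPRK3.IsSteadyState A y0 x → x = ystar) ∧
    ∀ Δt : ℝ, 0 < Δt →
    ∀ η2 ∈ Set.Icc (0 : ℝ) SSPMPRK3.r1,
    ∀ s ∈ Set.Icc (5.6 : ℝ) 5.75,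
      ∃ δ > 0, ∀ z : Fin N → ℝ, (∀ i, 0 < z i) → SSPMPRK3.SameInvariants A z ystar →
        ‖z - ystar‖ < δ →
          (∃! Y : ℕ → Fin N → ℝ,
            SSPMPRK3.IsIterates (SSPMPRK3.linearProduction A) η2 s Δt z Y) ∧
          ∀ Y : ℕ → Fin N → ℝ,
            SSPMPRK3.IsIterates (SSPMPRK3.linearProduction A) η2 s Δt z Y →
              (∀ n i, 0 < Y n i) ∧ Tendsto Y atTop (𝓝 ystar) := by
  open SSPMPRK3 in
  obtain ⟨hA, hinv⟩ := hsteady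
  refine ⟨fun x hx => ?_, fun Δt hΔt η2 hη2 s hs => ?_⟩
  · refine sub_eq_zero.1 (eq_zero_of_mulVec_eq_zero hMetzler hcons hpos hA ?_ ?_)
    · rw [mulVec_sub, hx.1, hA, sub_zero]
    · intro n hn
      rw [dotProduct_sub, hx.2 n hn, hinv n hn, sub_self]
  have hcol := sum_col_eq_zero hcons
  have hBM : ∀ i j, i ≠ j → 0 ≤ (Δt • A) i j := fun i j hij =>
    mul_nonneg hΔt.le (hMetzler i j hij)
  have hBt : ∀ n : Fin N → ℝ, (Δt • A)ᵀ *ᵥ n = 0 ↔ Aᵀ *ᵥ n = 0 := fun n => by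
    rw [transpose_smul, smul_mulVec, smul_eq_zero, or_iff_right hΔt.ne']
  have hBcons := (hBt _).2 hcons
  have hBy : (Δt • A) *ᵥ ystar = 0 := by rw [smul_mulVec, hA, smul_zero]
  have hdet : ∀ c : ℝ, 0 < c → (1 - c • Δt • A).det ≠ 0 := fun c hc =>
    det_one_sub_smul_ne_zero hBM hBcons hpos hBy hc
  obtain ⟨k, hk, θ, hθ0, hθ1, hθ⟩ :=
    exists_pow_linStep_contraction hBM hBcons hpos hBy hη2 hs
  have hpow : ∀ (j : ℕ) (v : Fin N → ℝ),
      ((linStep (Δt • A) η2 s).mulVecLin.toContinuousLinearMap ^ j) v =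
        (linStep (Δt • A) η2 s ^ j) *ᵥ v := by
    intro j
    induction j with
    | zero => intro v; simp
    | succ j ih =>
      intro v
      rw [pow_succ, mul_apply_eq_comp, ih, pow_succ, ← mulVec_mulVec]
      rfl
  have hU := eventually_isStep_iff hcol hpos hBy hdet hη2.2 s
  -- U is the neighbourhood on which vectors are positive and the step is single-valued; V consists
  -- of the errors without linear invariants, preserved because each step keeps the invariants.
  obtain ⟨δ, hδ, H⟩ := exists_forall_tendsto_iterate (stepMap_eq hpos hBy hdet hη2.2 s)
    (hasFDerivAt_stepMap hpos hBy hdet hη2.2 s) (V := {v | ∀ n, Aᵀ *ᵥ n = 0 → n ⬝ᵥ v = 0}) hU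
    (fun y hy hV n hn => by
      have h1 := dotProduct_eq_of_isStep hcol ((hy.2 _).2 rfl) hn
      have h2 := hV n hn
      rw [dotProduct_sub] at h2 ⊢
      rw [h1, h2])
    hk hθ0 hθ1 (fun v hv => by
      rw [hpow]
      exact hθ v fun n hn => hv n ((hBt n).1 hn))
  refine ⟨δ, hδ, fun z _ hz hzδ => ?_⟩
  obtain ⟨h1, h2⟩ := H z (sameInvariants_iff.1 hz) hzδ
  have hiff := isIterates_iff fun n => (h1 n).1.2
  refine ⟨⟨_, (hiff _).2 rfl, fun Y hY => (hiff Y).1 hY⟩, fun Y hY => ?_⟩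
  rw [(hiff Y).1 hY]
  exact ⟨fun n => (h1 n).1.1, h2⟩
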